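/- Let $V$ be a finite set of $n$ buyers and let $G$ be an undirected social network on $V$, i.e. a family of weights $w_{ij}=w_{ji}\ge 0$, $i,j\in V$ (loops $w_{ii}\ge 0$ are allowed; $w_{ij}=0$ if there is no edge). Under the Uniform Additive Model, the marketing strategy that approaches the buyers in the order $\pi$ with pricing (acceptance) probabilities $(q_i)_{i\in V}$ has expected revenue $$R(\pi,q)=\sum_{i\in V}q_i(1-q_i)\Bigl(w_{ii}+\sum_{j:\,\pi_j<\pi_i}q_jw_{ji}\Bigr).$$ For $A\subseteq V$ and $p\in[1/2,1)$, the Influence-and-Exploit (IE) strategy $\mathrm{IE}(A,p)$ first gives the product for free to the buyers of $A$ ($q_i=1$) and then approaches the buyers of $V\setminus A$ in uniformly random order with pricing probability $q_i=p$. Let $R_{IE}(A,p)$ denote its expected revenue; explicitly, $$R_{IE}(A,p)=p(1-p)\sum_{i\in V\setminus A}\Bigl(w_{ii}+\sum_{j\in A}w_{ji}+\sum_{j\in V\setminus A,\,j\ne i}\tfrac{p\,w_{ji}}{2}\Bigr).$$ For a parameter $\gamma\in[0,1]$, the algorithm $\mathrm{SDP\text{-}IE}(p,\gamma)$ works as follows.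 Fix any linear order on $V$. 1. It takes an optimal solution $v_0$, $(v_i)_{i\in V}$ of the semidefinite relaxation (S2): maximize $$\tfrac{p(1-p)}{2}\sum_{i\in V}w_{ii}(1-v_0\cdot v_i)+\tfrac{p(1-p)}{4}\sum_{i<j}w_{ij}\bigl(2+p-p\,v_0\cdot v_i-p\,v_0\cdot v_j-(2-p)\,v_i\cdot v_j\bigr)$$ over unit vectors $v_0,v_i\in\mathbb{R}^{n+1}$ such that, for all $i,j\in V$, the four numbers $v_i\cdot v_j+v_0\cdot v_i+v_0\cdot v_j$, $\;v_i\cdot v_j-v_0\cdot v_i-v_0\cdot v_j$, $\;-v_i\cdot v_j-v_0\cdot v_i+v_0\cdot v_j$ and $-v_i\cdot v_j+v_0\cdot v_i-v_0\cdot v_j$ are all at least $-1$. 2. With $\theta_i=\arccos(v_0\cdot v_i)$, it replaces each $v_i$ by the unit vector $v_i'$ that is coplanar with $v_0$ and $v_i$, lies on the same side of $v_0$ as $v_i$, and forms with $v_0$ the angle $f_\gamma(\theta_i)=(1-\gamma)\theta_i+\gamma\pi(1-\cos\theta_i)/2$ (so $v_i'=v_i$ if $v_i=\pm v_0$). 3.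 It draws $r$ uniformly at random from the unit sphere of $\mathbb{R}^{n+1}$ and outputs $\mathrm{IE}(A_r,p)$ with the influence set $A_r=\{i\in V:\mathrm{sgn}(v_i'\cdot r)=\mathrm{sgn}(v_0\cdot r)\}$, where $\mathrm{sgn}(x)=1$ if $x\ge 0$ and $-1$ otherwise. **Theorem.** For every undirected social network $G$ and $p=0.586$, the relaxation (S2) has an optimal solution, and for each of its optimal solutions the influence set $A_r$ computed by $\mathrm{SDP\text{-}IE}(0.586,0.209)$ satisfies $$\mathbb{E}_r\bigl[R_{IE}(A_r,0.586)\bigr]\;\ge\;0.9032\cdot\max_{A\subseteq V}R_{IE}(A,0.586),$$ where the expectation on the left is well defined (the revenue is an integrable function of $r$). -/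

import Mathlib

open MeasureTheory

open scoped RealInnerProductSpace

noncomputable section

namespace SocialNetwork

/-! ### Undirected social networks and Influence-and-Exploit strategies -/

/-- An undirected social network on the set `V` of buyers, given by its symmetric non-negative
weights; `w i j = 0` means that there is no edge between `i` and `j` (no loop, if `i = j`). -/
structure UndirectedNetwork (V : Type*) where
  w : V → V → ℝ
  symm : ∀ i j, w i j = w j i
  nonneg : ∀ i j, 0 ≤ w i j

section Revenue

variable {V : Type*} [Fintype V] [DecidableEq V]

/-- An order in which the buyers are approached: `π i` is the position of buyer `i`. -/
abbrev Ordering (V : Type*) [Fintype V] := V ≃ Fin (Fintype.card V)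

/-- The expected revenue `R(π, q) = ∑ i, q i (1 - q i) (w i i + ∑_{j : π j < π i} q j w j i)`, under
the Uniform Additive Model, of the marketing strategy that approaches the buyers in the order `π`
with pricing probabilities `q`. -/
def revenue (G : UndirectedNetwork V) (π : Ordering V) (q : V → ℝ) : ℝ :=
  ∑ i, q i * (1 - q i) * (G.w i i + ∑ j with π j < π i, q j * G.w j i)

/-- The pricing probabilities of `IE(A, p)`: the buyers in `A` get the product for free, and all
others are offered the pricing probability `p`. -/
def iePricing (A : Finset V) (p : ℝ) (i : V) : ℝ := if i ∈ A then 1 else p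

/-- The orderings in which the influence set `A` precedes the exploit set `V \ A`. -/
def ieOrderings (A : Finset V) : Finset (Ordering V) :=
  {π : Ordering V | ∀ a ∈ A, ∀ b ∉ A, π a < π b}

/-- The expected revenue of the strategy `IE(A, p)`, where the influence set `A` comes first and the
buyers in the exploit set are approached in a uniformly random order. -/
def ieRevenue (G : UndirectedNetwork V) (A : Finset V) (p : ℝ) : ℝ :=
  (∑ π ∈ ieOrderings A, revenue G π (iePricing A p)) / (ieOrderings A).card

/-- The revenue of the best IE strategy with pricing probability `p`. -/
def bestIERevenue (G : UndirectedNetwork V) (p : ℝ) : ℝ :=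
  Finset.univ.sup' Finset.univ_nonempty fun A : Finset V => ieRevenue G A p

theorem ieOrderings_nonempty (A : Finset V) : (ieOrderings A).Nonempty := by
  classical
  let e : V ≃ Fin (Fintype.card V) := Fintype.equivFin V
  let key : V → ℕ ×ₗ Fin (Fintype.card V) := fun i => toLex (if i ∈ A then 0 else 1, e i)
  have hkey : Function.Injective key := by
    intro i j h
    have := congrArg (fun z => (ofLex z).2) h
    exact e.injective this
  let _ : LinearOrder V := LinearOrder.lift' key hkey
  let o : Fin (Fintype.card V) ≃o V := Fintype.orderIsoFinOfCardEq V rfl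
  refine ⟨o.symm.toEquiv, ?_⟩
  simp only [ieOrderings, Finset.mem_filter, Finset.mem_univ, true_and]
  intro a ha b hb
  have : a < b := by
    change key a < key b
    simp [key, ha, hb, Prod.Lex.toLex_lt_toLex]
  exact o.symm.lt_iff_lt.mpr this

theorem ieOrderings_swap_mem {A : Finset V} {i j : V} (hi : i ∉ A) (hj : j ∉ A)
    {π : Ordering V} (h : π ∈ ieOrderings A) : (Equiv.swap i j).trans π ∈ ieOrderings A := by
  simp only [ieOrderings, Finset.mem_filter, Finset.mem_univ, true_and] at h ⊢
  intro a ha b hb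
  have h1 : Equiv.swap i j a = a :=
    Equiv.swap_apply_of_ne_of_ne (fun h => hi (h ▸ ha)) (fun h => hj (h ▸ ha))
  have h2 : Equiv.swap i j b ∉ A := by
    rw [Equiv.swap_apply_def]
    split_ifs <;> assumption
  simpa [h1] using h a ha _ h2

/-- Two distinct buyers in the exploit set appear in either order with probability `1/2`. -/
theorem sum_ieOrderings_lt {A : Finset V} {i j : V} (hi : i ∉ A) (hj : j ∉ A) (hij : j ≠ i) :
    (∑ π ∈ ieOrderings A, if π j < π i then (1 : ℝ) else 0) = (ieOrderings A).card / 2 := by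
  have h1 : (∑ π ∈ ieOrderings A, if π j < π i then (1 : ℝ) else 0) =
      ∑ π ∈ ieOrderings A, if π i < π j then (1 : ℝ) else 0 := by
    refine Finset.sum_nbij' (fun π => (Equiv.swap i j).trans π)
      (fun π => (Equiv.swap i j).trans π) (fun π h => ieOrderings_swap_mem hi hj h)
      (fun π h => ieOrderings_swap_mem hi hj h) ?_ ?_ ?_
    · intro π _; ext x; simp
    · intro π _; ext x; simp
    · intro π _; simp
  have h2 : (∑ π ∈ ieOrderings A, if π j < π i then (1 : ℝ) else 0) +
      (∑ π ∈ ieOrderings A, if π i < π j then (1 : ℝ) else 0) = (ieOrderings A).card := by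
    rw [← Finset.sum_add_distrib, Finset.card_eq_sum_ones, Nat.cast_sum]
    refine Finset.sum_congr rfl fun π _ => ?_
    have : π j ≠ π i := fun h => hij (π.injective h)
    rcases lt_or_gt_of_ne this with h | h
    · simp [h, h.not_gt]
    · simp [h, h.not_gt]
  linarith

/-- The closed form of the revenue of `IE(A, p)`. -/
theorem ieRevenue_eq (G : UndirectedNetwork V) (A : Finset V) (p : ℝ) :
    ieRevenue G A p = p * (1 - p) * ∑ i ∈ Aᶜ, (G.w i i + ∑ j ∈ A, G.w j i +
      ∑ j ∈ Aᶜ with j ≠ i, p * G.w j i / 2) := by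
  have hc : ((ieOrderings A).card : ℝ) ≠ 0 := by
    exact_mod_cast (Finset.card_pos.mpr (ieOrderings_nonempty A)).ne'
  have hrev : ∀ π ∈ ieOrderings A, revenue G π (iePricing A p) =
      p * (1 - p) * ∑ i ∈ Aᶜ, (G.w i i + ∑ j ∈ A, G.w j i +
        ∑ j ∈ Aᶜ with j ≠ i, (p * G.w j i) * (if π j < π i then 1 else 0)) := by
    intro π hπ
    simp only [ieOrderings, Finset.mem_filter, Finset.mem_univ, true_and] at hπ
    rw [revenue, ← Finset.sum_add_sum_compl A, Finset.sum_eq_zero, zero_add, Finset.mul_sum]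
    · refine Finset.sum_congr rfl fun i hi => ?_
      have hi' : i ∉ A := by simpa using hi
      have hp : iePricing A p i = p := by simp [iePricing, hi']
      rw [hp, Finset.sum_filter, ← Finset.sum_add_sum_compl A, add_assoc]
      congr 3
      · refine Finset.sum_congr rfl fun j hj => ?_
        simp [iePricing, hj, hπ j hj i hi']
      · rw [Finset.sum_filter]
        refine Finset.sum_congr rfl fun j hj => ?_
        have hj' : j ∉ A := by simpa using hj
        by_cases hji : j = i
        · simp [hji]
        · simp [iePricing, hj', hji]
    · intro i hi
      simp [iePricing, hi]
  rw [ieRevenue, Finset.sum_congr rfl hrev, ← Finset.mul_sum, Finset.sum_comm, mul_div_assoc,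
    Finset.sum_div]
  congr 1
  refine Finset.sum_congr rfl fun i hi => ?_
  have hi' : i ∉ A := by simpa using hi
  rw [Finset.sum_add_distrib, Finset.sum_const, nsmul_eq_mul, Finset.sum_comm, add_div,
    mul_div_cancel_left₀ _ hc, Finset.sum_div]
  congr 1
  refine Finset.sum_congr rfl fun j hj => ?_
  have hj' := Finset.mem_filter.mp hj
  rw [← Finset.mul_sum, sum_ieOrderings_lt hi' (by simpa using hj'.1) hj'.2]
  field_simp

end Revenue

/-! ### The semidefinite relaxation -/

section SDP

variable {V : Type*} [Fintype V]

/-- The space `ℝ^(n+1)`, where `n` is the number of buyers. -/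
abbrev Vec (V : Type*) [Fintype V] := EuclideanSpace ℝ (Fin (Fintype.card V + 1))

/-- Feasibility for the relaxation; `v none` is the vector `v₀`, and `v (some i)` is the vector of
buyer `i`. -/
structure IsFeasible (v : Option V → Vec V) : Prop where
  unit : ∀ i, ⟪v i, v i⟫ = 1
  triangle₁ : ∀ i j : V,
    -1 ≤ ⟪v (some i), v (some j)⟫ + ⟪v none, v (some i)⟫ + ⟪v none, v (some j)⟫
  triangle₂ : ∀ i j : V,
    -1 ≤ ⟪v (some i), v (some j)⟫ - ⟪v none, v (some i)⟫ - ⟪v none, v (some j)⟫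
  triangle₃ : ∀ i j : V,
    -1 ≤ -⟪v (some i), v (some j)⟫ - ⟪v none, v (some i)⟫ + ⟪v none, v (some j)⟫
  triangle₄ : ∀ i j : V,
    -1 ≤ -⟪v (some i), v (some j)⟫ + ⟪v none, v (some i)⟫ - ⟪v none, v (some j)⟫

/-- The objective of the relaxation. The linear order on the buyers only serves to list every edge
`{i, j}` once, as `i < j`. -/
def sdpObjective [LinearOrder V] (G : UndirectedNetwork V) (p : ℝ) (v : Option V → Vec V) : ℝ :=
  p * (1 - p) / 2 * ∑ i, G.w i i * (1 - ⟪v none, v (some i)⟫) +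
    p * (1 - p) / 4 * ∑ i, ∑ j with i < j, G.w i j *
      (2 + p - p * ⟪v none, v (some i)⟫ - p * ⟪v none, v (some j)⟫ -
        (2 - p) * ⟪v (some i), v (some j)⟫)

/-- `v` is an optimal solution to the relaxation. -/
def IsOptimal [LinearOrder V] (G : UndirectedNetwork V) (p : ℝ) (v : Option V → Vec V) : Prop :=
  IsFeasible v ∧ ∀ u, IsFeasible u → sdpObjective G p u ≤ sdpObjective G p v

end SDP

/-! ### Rotation -/

section Rotation

variable {E : Type*} [NormedAddCommGroup E] [InnerProductSpace ℝ E]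

/-- The rotated angle `f_γ(θ) = (1 - γ) θ + γ π (1 - cos θ) / 2`. -/
def rotAngle (γ θ : ℝ) : ℝ := (1 - γ) * θ + γ * Real.pi * (1 - Real.cos θ) / 2

/-- The component of `x` orthogonal to the unit vector `x₀`. -/
def orthPart (x₀ x : E) : E := x - ⟪x₀, x⟫ • x₀

/-- For unit vectors `x₀`, `x` at angle `θ = arccos ⟪x₀, x⟫`, the unit vector that is coplanar with
`x₀` and `x`, lies on the same side of `x₀` as `x`, and forms the angle `f_γ(θ)` with `x₀`.
If `x = x₀` or `x = -x₀`, this is `x` itself. -/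
def rotate (γ : ℝ) (x₀ x : E) : E :=
  Real.cos (rotAngle γ (Real.arccos ⟪x₀, x⟫)) • x₀ +
    (Real.sin (rotAngle γ (Real.arccos ⟪x₀, x⟫)) * ‖orthPart x₀ x‖⁻¹) • orthPart x₀ x

theorem rotate_mem_span (γ : ℝ) (x₀ x : E) : rotate γ x₀ x ∈ Submodule.span ℝ {x₀, x} := by
  have h0 : x₀ ∈ Submodule.span ℝ {x₀, x} := Submodule.subset_span (by simp)
  have h1 : x ∈ Submodule.span ℝ {x₀, x} := Submodule.subset_span (by simp)
  exact add_mem (Submodule.smul_mem _ _ h0)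
    (Submodule.smul_mem _ _ (sub_mem h1 (Submodule.smul_mem _ _ h0)))

theorem rotAngle_mem {γ θ : ℝ} (hγ : γ ∈ Set.Icc (0 : ℝ) 1) (hθ : θ ∈ Set.Icc 0 Real.pi) :
    rotAngle γ θ ∈ Set.Icc 0 Real.pi := by
  obtain ⟨h0, h1⟩ := hγ
  obtain ⟨h2, h3⟩ := hθ
  have h4 := Real.neg_one_le_cos θ
  have h5 := Real.cos_le_one θ
  have hpi := Real.pi_pos
  have e1 : 0 ≤ (1 - γ) * θ := mul_nonneg (by linarith) h2
  have e2 : 0 ≤ γ * Real.pi * (1 - Real.cos θ) :=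
    mul_nonneg (mul_nonneg h0 hpi.le) (by linarith)
  have e3 : 0 ≤ (1 - γ) * (Real.pi - θ) := mul_nonneg (by linarith) (by linarith)
  have e4 : 0 ≤ γ * Real.pi * (1 + Real.cos θ) :=
    mul_nonneg (mul_nonneg h0 hpi.le) (by linarith)
  constructor
  · unfold rotAngle; linarith
  · unfold rotAngle; nlinarith

theorem inner_orthPart {x₀ : E} (h₀ : ‖x₀‖ = 1) (x : E) : ⟪x₀, orthPart x₀ x⟫ = 0 := by
  simp [orthPart, inner_sub_right, inner_smul_right, h₀]

theorem inner_rotate (γ : ℝ) {x₀ : E} (h₀ : ‖x₀‖ = 1) (x : E) :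
    ⟪x₀, rotate γ x₀ x⟫ = Real.cos (rotAngle γ (Real.arccos ⟪x₀, x⟫)) := by
  simp [rotate, inner_add_right, inner_smul_right, inner_orthPart h₀, h₀]

/-- The rotated vector forms the angle `f_γ(θ)` with `x₀`. -/
theorem arccos_inner_rotate {γ : ℝ} (hγ : γ ∈ Set.Icc (0 : ℝ) 1) {x₀ : E} (h₀ : ‖x₀‖ = 1) (x : E) :
    Real.arccos ⟪x₀, rotate γ x₀ x⟫ = rotAngle γ (Real.arccos ⟪x₀, x⟫) := by
  have h := rotAngle_mem hγ ⟨Real.arccos_nonneg ⟪x₀, x⟫, Real.arccos_le_pi ⟪x₀, x⟫⟩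
  rw [inner_rotate γ h₀, Real.arccos_cos h.1 h.2]

/-- The rotated vector has length `1`. -/
theorem norm_rotate (γ : ℝ) {x₀ x : E} (h₀ : ‖x₀‖ = 1) (h : ‖x‖ = 1) : ‖rotate γ x₀ x‖ = 1 := by
  by_cases hz : orthPart x₀ x = 0
  · have hx : x = ⟪x₀, x⟫ • x₀ := by simpa [orthPart, sub_eq_zero] using hz
    have hc : |⟪x₀, x⟫| = 1 := by
      have := congrArg norm hx
      rw [norm_smul, h₀, h, mul_one, Real.norm_eq_abs] at this
      exact this.symm
    rw [rotate, hz, smul_zero, add_zero, norm_smul, h₀, mul_one, Real.norm_eq_abs]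
    rcases (abs_eq zero_le_one).mp hc with hc | hc
    · simp [hc, rotAngle]
    · rw [hc, rotAngle, Real.arccos_neg_one, Real.cos_pi]
      rw [show (1 - γ) * Real.pi + γ * Real.pi * (1 - -1) / 2 = Real.pi by ring]
      simp
  · have hn : ‖orthPart x₀ x‖ ≠ 0 := norm_ne_zero_iff.mpr hz
    have hsq : ‖rotate γ x₀ x‖ ^ 2 = 1 := by
      rw [rotate, norm_add_sq_real, norm_smul, norm_smul, inner_smul_left, inner_smul_right,
        inner_orthPart h₀, h₀, norm_mul, norm_inv, norm_norm, inv_mul_cancel_right₀ hn]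
      simp
    nlinarith [norm_nonneg (rotate γ x₀ x)]

/-- The rotated vector lies on the same side of `x₀` as `x`. -/
theorem orthPart_rotate (γ : ℝ) {x₀ : E} (h₀ : ‖x₀‖ = 1) (x : E) :
    orthPart x₀ (rotate γ x₀ x) =
      (Real.sin (rotAngle γ (Real.arccos ⟪x₀, x⟫)) * ‖orthPart x₀ x‖⁻¹) • orthPart x₀ x := by
  conv_lhs => rw [orthPart, inner_rotate γ h₀]
  rw [rotate, add_sub_cancel_left]

end Rotation

/-! ### Rounding by a random hyperplane -/

section Rounding

variable {V : Type*} [Fintype V] [DecidableEq V]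

/-- The uniform probability distribution on the unit sphere of `ℝ^(n+1)`: the normalized
surface measure. -/
def uniformSphere (V : Type*) [Fintype V] : Measure (Metric.sphere (0 : Vec V) 1) :=
  ((volume : Measure (Vec V)).toSphere Set.univ)⁻¹ • (volume : Measure (Vec V)).toSphere

instance : IsProbabilityMeasure (uniformSphere V) := by
  refine ⟨?_⟩
  have h0 : (volume : Measure (Vec V)).toSphere Set.univ ≠ 0 := by
    rw [Measure.toSphere_apply_univ]
    exact mul_ne_zero (by simp) (Metric.measure_ball_pos _ _ one_pos).ne'
  rw [uniformSphere, Measure.smul_apply, smul_eq_mul,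
    ENNReal.inv_mul_cancel h0 (measure_ne_top _ _)]

/-- The sign convention `sgn x = 1` if `x ≥ 0`, and `-1` otherwise. -/
def sgn (x : ℝ) : ℤ := if 0 ≤ x then 1 else -1

/-- The influence set computed by rotating the vectors `v` with parameter `γ` and cutting them
with the hyperplane orthogonal to `r`. -/
def roundedSet (γ : ℝ) (v : Option V → Vec V) (r : Vec V) : Finset V :=
  {i : V | sgn ⟪rotate γ (v none) (v (some i)), r⟫ = sgn ⟪v none, r⟫}

/-- The revenue `R_IE(A, p)` of the IE strategy computed by `SDP-IE(p, γ)` from the solution `v` of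
the relaxation and the random vector `r`. -/
def sdpIERevenue (G : UndirectedNetwork V) (p γ : ℝ) (v : Option V → Vec V)
    (r : Metric.sphere (0 : Vec V) 1) : ℝ :=
  ieRevenue G (roundedSet γ v r) p

end Rounding

end SocialNetwork

end

/-! Both the expected revenue and the relaxation are sums over loops and edges with non-negative
weights, so it suffices to compare them term by term. Let `b` be the indicator of the exploit set.
Up to the factor p(1-p), an edge of unit weight contributes b_i + b_j - (2-p) b_i b_j = (p/2)(b_i +
b_j) + (1 - p/2) [b_i ≠ b_j]. Its expectation therefore involves only probabilities that a random
hyperplane separates two unit vectors, and each of these is at least the angle divided by π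
(`le_uniformSphere_separating`). On the other side, every influence set yields a feasible solution
with all v_i = ±v₀ and the same value, so the best IE revenue is at most the optimum of the
relaxation (`bestIERevenue_le_sdpObjective`).

What remains is an inequality for a single edge. Let a, b now be the angles of v_i, v_j with v₀, and
let k be the cosine of the dihedral angle at v₀, which the rotation preserves. The cosines of the
angle between the two vectors, before and after rotation, are z = cos a cos b + k sin a sin b and c
= cos f(a) cos f(b) + k sin f(a) sin f(b). Multiplied by 2π, the edge inequality is `edgeGap a b c z
≥ 0`. The triangle inequality v_i·v_j + v₀·v_i + v₀·v_j ≥ -1 becomes k ≥ -cot(a/2) cot(b/2);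
equality there is called the face. The loop inequality is the edge inequality for two equal vectors.

Both c and z are affine in k. Once arccos is replaced by a line below its graph, the gap is affine
in k, and only the two ends of the range of k matter: k = 1, and k = -1 or the face. The line is one
of finitely many fixed ones, or the chord of arccos from the face value to (1, 0), whose slope is
compared with the Goemans–Williamson constant κ = min θ/(1 - cos θ) (`edgeGap_nonneg_of_chord`).

The remaining inequalities in (a, b) are verified by branch and bound on a square containing [0,
π]², with affine models in integer arithmetic evaluated by the kernel (`checkDiag_lines`). Equality
holds at a = b = 0, so that corner is treated by hand (`edgeGap_nonneg_of_add_le`): there the gain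
is linear and the loss quadratic. -/

namespace SocialNetwork

/-! ### Affine models in fixed-point arithmetic -/

/-- The denominator of all fixed-point numbers. -/
abbrev fixedOne : ℤ := 4294967296

/-- Reduces `x` to a numeral before it is passed on, when evaluated by the kernel. -/
def forceInt {α : Type*} (x : ℤ) (k : ℤ → α) : α :=
  match x with
  | .ofNat 0 => k (.ofNat 0)
  | .ofNat (n + 1) => k (.ofNat (n + 1))
  | .negSucc 0 => k (.negSucc 0)
  | .negSucc (n + 1) => k (.negSucc (n + 1))

theorem forceInt_eq {α : Type*} (x : ℤ) (k : ℤ → α) : forceInt x k = k x := by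
  unfold forceInt
  split <;> rfl

/-- The Horner scheme `1 - x² / ((2j + o + 1)(2j + o + 2)) * (1 - …)` with `n` levels for the series
of sine (`o = 1`) and cosine (`o = 0`): its denominator, for `x` with denominator `fixedOne`. -/
def hornerDen (o : ℤ) : ℕ → ℤ → ℤ
  | 0, _ => 1
  | n + 1, j => (2 * j + o + 1) * (2 * j + o + 2) * (fixedOne * fixedOne) * hornerDen o n (j + 1)

/-- The numerator that belongs to `hornerDen`. -/
def hornerNum (o x : ℤ) : ℕ → ℤ → ℤ
  | 0, _ => 1
  | n + 1, j => (2 * j + o + 1) * (2 * j + o + 2) * (fixedOne * fixedOne) * hornerDen o n (j + 1) -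
      x * x * hornerNum o x n (j + 1)

/-- `cos x` in fixed-point arithmetic. -/
def fixedCos (x : ℤ) : ℤ := fixedOne * hornerNum 0 x 13 0 / hornerDen 0 13 0

/-- `sin x` in fixed-point arithmetic. -/
def fixedSin (x : ℤ) : ℤ := x * hornerNum 1 x 13 0 / hornerDen 1 13 0

/-- The absolute value of an integer. -/
def iabs (x : ℤ) : ℤ := x.natAbs

/-- An affine model `c + l s ± e`, `|s| ≤ 1`, of a function of one variable. -/
structure Lin where
  c : ℤ
  l : ℤ
  e : ℤ

namespace Lin

def mkForced (c l e : ℤ) : Lin := forceInt c fun c => forceInt l fun l => forceInt e fun e => ⟨c, l, e⟩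

def const (n : ℤ) (e : ℤ) : Lin := ⟨n, 0, e⟩

def add (a b : Lin) : Lin := mkForced (a.c + b.c) (a.l + b.l) (a.e + b.e)

def sub (a b : Lin) : Lin := mkForced (a.c - b.c) (a.l - b.l) (a.e + b.e)

def scale (n d : ℕ) (a : Lin) : Lin :=
  mkForced (n * a.c / d) (n * a.l / d) (n * a.e / d + 3)

def mul (a b : Lin) : Lin :=
  mkForced (a.c * b.c / fixedOne) ((a.c * b.l + a.l * b.c) / fixedOne)
    ((iabs a.l * iabs b.l + (iabs a.c + iabs a.l) * b.e + (iabs b.c + iabs b.l) * a.e + a.e * b.e) /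
      fixedOne + 3)

/-- The models come from 1/(c + δ) = 1/c - δ/c² + δ²/(c²(c + δ)). The result is meaningful only if c
- |l| - e is positive, which callers have to check. -/
def inv (a : Lin) : Lin :=
  mkForced (fixedOne * fixedOne / a.c) (-(fixedOne * fixedOne * a.l / (a.c * a.c)))
    (fixedOne * fixedOne * a.e / (a.c * a.c) +
      fixedOne * fixedOne * (iabs a.l + a.e) * (iabs a.l + a.e) /
        (a.c * a.c * (a.c - iabs a.l - a.e)) + 4)

/-- Outside [-4, 4] the Taylor polynomial is not controlled, and the trivial model 0 ± 1 is used. -/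
def cos (a : Lin) : Lin :=
  if iabs a.c ≤ 4 * fixedOne then
    mkForced (fixedCos a.c) (-(fixedSin a.c * a.l / fixedOne))
      (a.e + ((iabs a.l + a.e) * (iabs a.l + a.e) + 4 * iabs a.l) / (2 * fixedOne) + 5)
  else ⟨0, 0, fixedOne⟩

def sin (a : Lin) : Lin :=
  if iabs a.c ≤ 4 * fixedOne then
    mkForced (fixedSin a.c) (fixedCos a.c * a.l / fixedOne)
      (a.e + ((iabs a.l + a.e) * (iabs a.l + a.e) + 4 * iabs a.l) / (2 * fixedOne) + 5)
  else ⟨0, 0, fixedOne⟩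

end Lin

/-- An affine model `c + l s + m t ± e`, `|s| ≤ 1`, `|t| ≤ 1`, of a function of two variables. -/
structure Lin₂ where
  c : ℤ
  l : ℤ
  m : ℤ
  e : ℤ

namespace Lin₂

def mkForced (c l m e : ℤ) : Lin₂ :=
  forceInt c fun c => forceInt l fun l => forceInt m fun m => forceInt e fun e => ⟨c, l, m, e⟩

def outerAdd (a b : Lin) : Lin₂ := mkForced (a.c + b.c) a.l b.l (a.e + b.e)

def outerMul (a b : Lin) : Lin₂ :=
  mkForced (a.c * b.c / fixedOne) (a.l * b.c / fixedOne) (a.c * b.l / fixedOne)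
    ((iabs a.l * iabs b.l + (iabs a.c + iabs a.l) * b.e + (iabs b.c + iabs b.l) * a.e + a.e * b.e) /
      fixedOne + 4)

def const (n : ℤ) (e : ℤ) : Lin₂ := ⟨n, 0, 0, e⟩

def add (a b : Lin₂) : Lin₂ := mkForced (a.c + b.c) (a.l + b.l) (a.m + b.m) (a.e + b.e)

def sub (a b : Lin₂) : Lin₂ := mkForced (a.c - b.c) (a.l - b.l) (a.m - b.m) (a.e + b.e)

def scale (n d : ℕ) (a : Lin₂) : Lin₂ :=
  mkForced (n * a.c / d) (n * a.l / d) (n * a.m / d) (n * a.e / d + 4)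

def lower (a : Lin₂) : ℤ := a.c - iabs a.l - iabs a.m - a.e

def upper (a : Lin₂) : ℤ := a.c + iabs a.l + iabs a.m + a.e

end Lin₂

/-! ### Branch and bound -/

/-- Affine models, on the cell with midpoint `mid` and radius `rad`, of the functions of one angle
that occur in the edge inequality. -/
structure Cell where
  mid : ℤ
  rad : ℤ
  cosA : Lin
  sinA : Lin
  cosR : Lin
  sinR : Lin
  half : Lin
  cotR : Lin
  phi : Lin
  cosP : Lin
  sinP : Lin
  piCos : Lin
  piSin : Lin
  base : Lin
  faceBase : Lin

/-- An affine model of `π`. -/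
def linPi : Lin := .const 13493037704 1

/-- Here `A` is the rotated angle, with 1 - γ = 791/1000 and γ/2 = 209/2000; `B` and `P` model
`edgeBase` and `facePhase`. With p = 0.586 and 0.9032/2 = 0.4516, the constants are 0.2646376 =
0.4516 p, 0.6385624 = 0.4516 (2-p), 0.5839188 = 0.4516 (2+p)/2 and 293/707 = p/(2-p). On the face z
= -1 - cos a - cos b, so the term in z splits between the two angles; this gives `faceBase`. -/
def mkCell (mid rad : ℤ) : Cell :=
  let a : Lin := Lin.mkForced mid rad 0
  let x := a.cos
  let A := (a.scale 791 1000).add ((linPi.mul ((Lin.const fixedOne 0).sub x)).scale 209 2000)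
  let w := A.sin
  let h := a.scale 1 2
  let P := ((linPi.mul ((Lin.const fixedOne 0).add (x.scale 207 500))).scale 4516 7070).sub
    (A.scale 293 707)
  let B := ((A.scale 293 500).add ((linPi.mul x).scale 2646376 10000000)).sub
      (linPi.scale 5839188 10000000)
  let px := (linPi.mul x).scale 6385624 10000000
  { mid := mid, rad := rad, cosA := x, sinA := a.sin, cosR := A.cos, sinR := w,
    half := h.sin, cotR := w.mul (h.cos.mul h.sin.inv), phi := P, cosP := P.cos, sinP := P.sin,
    piCos := px, piSin := (linPi.mul a.sin).scale 6385624 10000000, base := B,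
    faceBase := (B.sub px).sub (linPi.scale 3192812 10000000) }

/-- A line `m - n c` below the graph of `arccos`. -/
structure Line where
  m : ℤ
  n : ℕ

/-- The tangent to arccos at angle t has n = 1/sin t and m = t + n cos t. The 1024 units taken off
leave room for the rounding errors. -/
def mkLine (t : ℤ) : Line :=
  forceInt (fixedOne * fixedOne / fixedSin t) fun n =>
    forceInt (t + n * fixedCos t / fixedOne - 1024) fun m => ⟨m, n.toNat⟩

/-- A line with equation `κ (1 - c)`. -/
def kappaLine : Line := ⟨5927054868, 5927054868⟩

def checkLine (base c : Lin₂) (k : Line) : Bool :=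
  0 ≤ ((base.add (.const (1414 * k.m / 1000) 1)).sub (c.scale (1414 * k.n) (1000 * 4294967296))).lower

/-- The bound -2954937500 stands for c ≥ -0.688, the range in which the chord argument applies. The
rest certifies arccos c ≥ `facePhase a + facePhase b`, through a non-positive phase or by comparing
cosines; 13493037703 lies below π in fixed point. -/
def checkFace (cf : Lin₂) (a b : Cell) : Bool :=
  -2954937500 ≤ cf.lower &&
  ((Lin₂.outerAdd a.phi b.phi).upper ≤ 0 ||
    ((Lin₂.outerAdd a.phi b.phi).upper ≤ 13493037703 &&
      0 ≤ (((Lin₂.outerMul a.cosP b.cosP).sub (Lin₂.outerMul a.sinP b.sinP)).sub cf).lower))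

/-- A pair of cells is settled if it lies in the corner a + b ≤ 0.3, or by the chord from the face,
or by one line that works at k = 1 and at the lower end of the range of k, which is either -1 or the
face. -/
def checkPair (L : List Line) (a b : Cell) : Bool :=
  a.mid + a.rad + b.mid + b.rad ≤ 1288490188 ||
  (let S := Lin₂.outerAdd a.base b.base
   let uu := Lin₂.outerMul a.cosR b.cosR
   let ww := Lin₂.outerMul a.sinR b.sinR
   let xx := Lin₂.outerMul a.piCos b.cosA
   let ss := Lin₂.outerMul a.piSin b.sinA
   let cp := uu.add ww
   let Sp := S.add (xx.add ss)
   let cm := uu.sub ww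
   let Sm := S.add (xx.sub ss)
   let cf := uu.sub (Lin₂.outerMul a.cotR b.cotR)
   let Sf := Lin₂.outerAdd a.faceBase b.faceBase
   -- Positivity of the models of sin(a/2) and sin(b/2) makes the cotangents valid. The threshold
   -- 12025908428, a sum of 2.8 for the midpoints, only selects where the face is tried and plays no
   -- role for soundness.
   let face : Bool := 0 < a.half.c - iabs a.half.l - a.half.e &&
     (0 < b.half.c - iabs b.half.l - b.half.e && 12025908428 ≤ a.mid + b.mid)
   (face && (checkLine Sp cp kappaLine && checkFace cf a b)) ||
   L.any fun k => checkLine Sp cp k && (checkLine Sm cm k || (face && checkLine Sf cf k)))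

/-- The one-variable models are attached to intervals, not to pairs of intervals, so all pairs with
a common side share them. -/
inductive CellTree where
  | leaf : CellTree
  | node : Cell → CellTree → CellTree → CellTree

def mkTree : ℕ → ℤ → ℤ → CellTree
  | 0, _, _ => .leaf
  | n + 1, mid, rad => forceInt mid fun mid => forceInt rad fun rad => forceInt ((rad + 1) / 2) fun r =>
      .node (mkCell mid rad) (mkTree n (mid - r) r) (mkTree n (mid + r) r)

def checkPairs (L : List Line) : CellTree → CellTree → Bool
  | .node a al ar, .node b bl br =>
      checkPair L a b || (checkPairs L al bl && (checkPairs L al br &&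
        (checkPairs L ar bl && checkPairs L ar br)))
  | _, _ => false

/-- The edge inequality is symmetric in the two angles, so one of the two off-diagonal blocks
suffices. -/
def checkDiag (L : List Line) : CellTree → Bool
  | .node a al ar =>
      checkPair L a a || (checkDiag L al && (checkDiag L ar && checkPairs L ar al))
  | _ => false

/-- The angles at which the lines of the branch and bound touch the graph of `arccos`. -/
def lineAngles : List ℤ :=
  [10015863734, 10445360463, 10874857192, 11304353921, 11733850650, 12163347379, 12592844108,
    13022340837, 13451837566]

def lines : List Line := kappaLine :: lineAngles.map mkLine

/-! ### Taylor expansion of sine and cosine -/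

/-- The derivative of a Taylor remainder is ω times the previous remainder, so the bound integrates
by induction. A general imaginary ω covers both I and -I, hence both signs of the argument. -/
theorem norm_cexp_sub_sum_le_of_nonneg {ω : ℂ} (h : ω.re = 0) (h1 : ‖ω‖ ≤ 1) (n : ℕ) {x : ℝ}
    (hx : 0 ≤ x) :
    ‖Complex.exp (ω * x) - ∑ k ∈ Finset.range n, (ω * x) ^ k / k.factorial‖ ≤
      x ^ n / n.factorial := by
  induction n generalizing x with
  | zero => simp [Complex.norm_exp, h]
  | succ n ih =>
    have hd : ∀ y : ℝ, HasDerivAt (fun y : ℝ => Complex.exp (ω * y) -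
        ∑ k ∈ Finset.range (n + 1), (ω * y) ^ k / k.factorial)
        (ω * (Complex.exp (ω * y) - ∑ k ∈ Finset.range n, (ω * y) ^ k / k.factorial)) y := by
      intro y
      have hl : HasDerivAt (fun y : ℝ => ω * (y : ℂ)) ω y := by
        simpa using (Complex.ofRealCLM.hasDerivAt (x := y)).const_mul ω
      have h2 : HasDerivAt (fun y : ℝ => ∑ k ∈ Finset.range (n + 1), (ω * y) ^ k / k.factorial)
          (∑ k ∈ Finset.range (n + 1), (k * (ω * y) ^ (k - 1) * ω) / k.factorial) y :=
        HasDerivAt.fun_sum fun k _ => (hl.pow k).div_const _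
      refine (hl.cexp.sub h2).congr_deriv ?_
      symm
      rw [Finset.sum_range_succ', mul_sub, Finset.mul_sum]
      simp only [Nat.cast_zero, zero_mul, zero_div, add_zero, Nat.add_sub_cancel]
      congr 1
      · ring
      · refine Finset.sum_congr rfl fun k _ => ?_
        rw [Nat.factorial_succ]
        push_cast
        have : (k : ℂ) + 1 ≠ 0 := by exact_mod_cast Nat.succ_ne_zero k
        have : (k.factorial : ℂ) ≠ 0 := by exact_mod_cast k.factorial_ne_zero
        field_simp
    have hB : ∀ y : ℝ, HasDerivAt (fun y : ℝ => y ^ (n + 1) / (n + 1).factorial)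
        (y ^ n / n.factorial) y := by
      intro y
      refine ((hasDerivAt_pow (n + 1) y).div_const _).congr_deriv ?_
      rw [Nat.factorial_succ]
      push_cast
      have : (n : ℝ) + 1 ≠ 0 := by positivity
      have : (n.factorial : ℝ) ≠ 0 := by positivity
      field_simp
    refine image_norm_le_of_norm_deriv_right_le_deriv_boundary (a := 0) (b := x)
      (fun y _ => (hd y).continuousAt.continuousWithinAt) (fun y _ => (hd y).hasDerivWithinAt)
      ?_ hB (fun y hy => ?_) ⟨hx, le_rfl⟩
    · simp [Finset.sum_range_succ']
    · rw [norm_mul]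
      exact (mul_le_of_le_one_left (norm_nonneg _) h1).trans (ih hy.1)

theorem norm_cexp_I_sub_sum_le (n : ℕ) (x : ℝ) :
    ‖Complex.exp (Complex.I * x) - ∑ k ∈ Finset.range n, (Complex.I * x) ^ k / k.factorial‖ ≤
      |x| ^ n / n.factorial := by
  rcases le_total 0 x with hx | hx
  · rw [abs_of_nonneg hx]
    exact norm_cexp_sub_sum_le_of_nonneg (by simp) (by simp) n hx
  · rw [abs_of_nonpos hx]
    have := norm_cexp_sub_sum_le_of_nonneg (ω := -Complex.I) (by simp) (by simp) n
      (neg_nonneg.mpr hx)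
    simpa using this

theorem sum_range_cexp_I (m : ℕ) (x : ℝ) :
    ∑ k ∈ Finset.range (2 * m), (Complex.I * x) ^ k / k.factorial =
      ((∑ k ∈ Finset.range m, (-1) ^ k * x ^ (2 * k) / (2 * k).factorial : ℝ) : ℂ) +
      ((∑ k ∈ Finset.range m, (-1) ^ k * x ^ (2 * k + 1) / (2 * k + 1).factorial : ℝ) : ℂ) *
        Complex.I := by
  induction m with
  | zero => simp
  | succ m ih =>
    rw [show 2 * (m + 1) = 2 * m + 1 + 1 by ring, Finset.sum_range_succ, Finset.sum_range_succ, ih,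
      Finset.sum_range_succ, Finset.sum_range_succ]
    push_cast
    have : Complex.I ^ (2 * m) = (-1) ^ m := by rw [pow_mul, Complex.I_sq]
    rw [pow_succ (Complex.I * (x : ℂ)), mul_pow, this]
    ring

theorem abs_cos_sub_sum_le (m : ℕ) (x : ℝ) :
    |Real.cos x - ∑ k ∈ Finset.range m, (-1) ^ k * x ^ (2 * k) / (2 * k).factorial| ≤
      |x| ^ (2 * m) / (2 * m).factorial := by
  refine le_trans ?_ (norm_cexp_I_sub_sum_le (2 * m) x)
  refine le_trans (le_of_eq ?_) (Complex.abs_re_le_norm _)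
  rw [sum_range_cexp_I, mul_comm Complex.I, Complex.exp_mul_I, Complex.sub_re, Complex.add_re,
    Complex.add_re, ← Complex.ofReal_cos, ← Complex.ofReal_sin, Complex.re_ofReal_mul,
    Complex.re_ofReal_mul]
  simp only [Complex.ofReal_re, Complex.I_re, mul_zero, add_zero]

theorem abs_sin_sub_sum_le (m : ℕ) (x : ℝ) :
    |Real.sin x - ∑ k ∈ Finset.range m, (-1) ^ k * x ^ (2 * k + 1) / (2 * k + 1).factorial| ≤
      |x| ^ (2 * m) / (2 * m).factorial := by
  refine le_trans ?_ (norm_cexp_I_sub_sum_le (2 * m) x)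
  refine le_trans (le_of_eq ?_) (Complex.abs_im_le_norm _)
  rw [sum_range_cexp_I, mul_comm Complex.I, Complex.exp_mul_I, Complex.sub_im, Complex.add_im,
    Complex.add_im, ← Complex.ofReal_cos, ← Complex.ofReal_sin, Complex.im_ofReal_mul,
    Complex.im_ofReal_mul]
  simp only [Complex.ofReal_im, Complex.I_im, mul_one, zero_add]

theorem cexp_I_re (x : ℝ) : (Complex.exp (Complex.I * x)).re = Real.cos x := by
  rw [mul_comm, Complex.exp_ofReal_mul_I_re]

theorem cexp_I_im (x : ℝ) : (Complex.exp (Complex.I * x)).im = Real.sin x := by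
  rw [mul_comm, Complex.exp_ofReal_mul_I_im]

theorem norm_cexp_I_add_sub_le (x d : ℝ) :
    ‖Complex.exp (Complex.I * (x + d : ℝ)) -
      Complex.exp (Complex.I * x) * (1 + Complex.I * d)‖ ≤ d ^ 2 / 2 := by
  have h := norm_cexp_I_sub_sum_le 2 d
  have e : Complex.exp (Complex.I * (x + d : ℝ)) -
      Complex.exp (Complex.I * x) * (1 + Complex.I * d) = Complex.exp (Complex.I * x) *
      (Complex.exp (Complex.I * d) -
        ∑ k ∈ Finset.range 2, (Complex.I * d) ^ k / k.factorial) := by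
    push_cast
    rw [mul_add, Complex.exp_add]
    simp [Finset.sum_range_succ]
    ring
  rw [e, norm_mul, Complex.norm_exp_I_mul_ofReal, one_mul]
  simpa using h

theorem abs_cos_add_sub_le (x d : ℝ) :
    |Real.cos (x + d) - (Real.cos x - Real.sin x * d)| ≤ d ^ 2 / 2 := by
  refine le_trans (le_of_eq ?_) ((Complex.abs_re_le_norm _).trans (norm_cexp_I_add_sub_le x d))
  rw [Complex.sub_re, Complex.mul_re, cexp_I_re, cexp_I_re, cexp_I_im]
  simp

theorem abs_sin_add_sub_le (x d : ℝ) :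
    |Real.sin (x + d) - (Real.sin x + Real.cos x * d)| ≤ d ^ 2 / 2 := by
  refine le_trans (le_of_eq ?_) ((Complex.abs_im_le_norm _).trans (norm_cexp_I_add_sub_le x d))
  rw [Complex.sub_im, Complex.mul_im, cexp_I_re, cexp_I_im, cexp_I_im]
  simp [add_comm]

/-! ### Soundness of the fixed-point sine and cosine -/

theorem abs_cast_ediv_sub_le (x : ℤ) {d : ℤ} (hd : 0 < d) : |((x / d : ℤ) : ℝ) - x / d| ≤ 1 := by
  have hd' : (0 : ℝ) < d := by exact_mod_cast hd
  have h1 := Int.ediv_mul_le x hd.ne'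
  have h2 := Int.lt_ediv_add_one_mul_self x hd
  have h1' : ((x / d : ℤ) : ℝ) * d ≤ x := by exact_mod_cast h1
  have h2' : (x : ℝ) < (((x / d : ℤ) : ℝ) + 1) * d := by exact_mod_cast h2
  rw [abs_le]
  constructor
  · have := (div_lt_iff₀ hd').mpr h2'
    linarith
  · have := (le_div_iff₀ hd').mpr h1'
    linarith

/-- The real value of the Horner scheme. -/
noncomputable def horner (o x : ℝ) : ℕ → ℝ → ℝ
  | 0, _ => 1
  | n + 1, j => 1 - x ^ 2 / ((2 * j + o + 1) * (2 * j + o + 2)) * horner o x n (j + 1)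

theorem hornerDen_pos {o : ℤ} (ho : 0 ≤ o) (n : ℕ) {j : ℤ} (hj : 0 ≤ j) : 0 < hornerDen o n j := by
  induction n generalizing j with
  | zero => simp [hornerDen]
  | succ n ih =>
    have := ih (j := j + 1) (by omega)
    unfold hornerDen
    positivity

theorem hornerNum_div {o : ℤ} (ho : 0 ≤ o) (x : ℤ) (n : ℕ) {j : ℤ} (hj : 0 ≤ j) :
    (hornerNum o x n j : ℝ) / hornerDen o n j = horner o (x / fixedOne) n j := by
  induction n generalizing j with
  | zero => simp [hornerNum, hornerDen, horner]
  | succ n ih =>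
    have h := hornerDen_pos ho n (j := j + 1) (by omega)
    have h' : (hornerDen o n (j + 1) : ℝ) ≠ 0 := by exact_mod_cast h.ne'
    have i := ih (j := j + 1) (by omega)
    have hj' : (0 : ℝ) ≤ j := by exact_mod_cast hj
    have ho' : (0 : ℝ) ≤ o := by exact_mod_cast ho
    have p1 : (2 * j + o + 1 : ℝ) ≠ 0 := by positivity
    have p2 : (2 * j + o + 2 : ℝ) ≠ 0 := by positivity
    have pS : (fixedOne : ℝ) ≠ 0 := by norm_num
    rw [div_eq_iff h'] at i
    simp only [hornerNum, hornerDen, horner]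
    push_cast at i ⊢
    rw [i]
    field_simp

theorem horner_zero_eq_sum (x : ℝ) :
    horner 0 x 13 0 = ∑ k ∈ Finset.range 14, (-1) ^ k * x ^ (2 * k) / (2 * k).factorial := by
  simp only [horner, Finset.sum_range_succ, Finset.sum_range_zero, Nat.factorial]
  norm_num
  ring

theorem mul_horner_one_eq_sum (x : ℝ) :
    x * horner 1 x 13 0 =
      ∑ k ∈ Finset.range 14, (-1) ^ k * x ^ (2 * k + 1) / (2 * k + 1).factorial := by
  simp only [horner, Finset.sum_range_succ, Finset.sum_range_zero, Nat.factorial]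
  norm_num
  ring

theorem taylor_remainder_le {x : ℝ} (hx : |x| ≤ 4) :
    fixedOne * (|x| ^ (2 * 14) / (2 * 14).factorial) ≤ (1 : ℝ) := by
  have : |x| ^ (2 * 14) ≤ 4 ^ 28 := pow_le_pow_left₀ (abs_nonneg x) hx 28
  rw [← mul_div_assoc, div_le_one (by positivity)]
  refine (mul_le_mul_of_nonneg_left this (by norm_num)).trans ?_
  norm_num [Nat.factorial]

theorem abs_div_fixedOne_le {x : ℤ} (hx : |x| ≤ 4 * fixedOne) : |(x : ℝ) / fixedOne| ≤ 4 := by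
  have : |(x : ℝ)| ≤ 4 * fixedOne := by exact_mod_cast hx
  rw [abs_div, abs_of_pos (a := ((fixedOne : ℤ) : ℝ)) (by norm_num), div_le_iff₀ (by norm_num)]
  exact this

/-- The Horner fraction is exact, so the error consists of one final floor division and the Taylor
remainder, each at most one unit. -/
theorem abs_fixedCos_sub_le {x : ℤ} (hx : |x| ≤ 4 * fixedOne) :
    |(fixedCos x : ℝ) - fixedOne * Real.cos (x / fixedOne)| ≤ 2 := by
  have hd := hornerDen_pos le_rfl 13 (o := 0) (j := 0) le_rfl
  have h1 := abs_cast_ediv_sub_le (fixedOne * hornerNum 0 x 13 0) hd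
  have h2 := hornerNum_div le_rfl x 13 (o := 0) (j := 0) le_rfl
  have h3 := abs_cos_sub_sum_le 14 ((x : ℝ) / fixedOne)
  have h4 := taylor_remainder_le (abs_div_fixedOne_le hx)
  push_cast at h1 h2 h3 h4 ⊢
  rw [mul_div_assoc, h2, horner_zero_eq_sum] at h1
  unfold fixedCos
  rw [abs_le] at h1 h3 ⊢
  constructor <;> linarith

theorem abs_fixedSin_sub_le {x : ℤ} (hx : |x| ≤ 4 * fixedOne) :
    |(fixedSin x : ℝ) - fixedOne * Real.sin (x / fixedOne)| ≤ 2 := by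
  have hd := hornerDen_pos zero_le_one 13 (o := 1) (j := 0) le_rfl
  have h1 := abs_cast_ediv_sub_le (x * hornerNum 1 x 13 0) hd
  have h2 := hornerNum_div zero_le_one x 13 (o := 1) (j := 0) le_rfl
  have h3 := abs_sin_sub_sum_le 14 ((x : ℝ) / fixedOne)
  have h4 := taylor_remainder_le (abs_div_fixedOne_le hx)
  have h5 := mul_horner_one_eq_sum ((x : ℝ) / fixedOne)
  push_cast at h1 h2 h3 h4 h5 ⊢
  rw [mul_div_assoc, h2] at h1
  rw [← h5] at h3
  unfold fixedSin
  rw [abs_le] at h1 h3 ⊢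
  constructor <;> linarith

/-! ### Soundness of affine models -/

theorem iabs_cast (x : ℤ) : ((iabs x : ℤ) : ℝ) = |(x : ℝ)| := by
  rw [iabs, Int.natCast_natAbs, Int.cast_abs]

theorem fixedOne_pos : (0 : ℝ) < fixedOne := by norm_num

/-- Floor division in the form in which it enters the error estimates. -/
theorem exists_cast_ediv_eq (x : ℤ) {d : ℤ} (hd : 0 < d) :
    ∃ r : ℝ, |r| ≤ 1 ∧ ((x / d : ℤ) : ℝ) = x / d + r :=
  ⟨_, abs_cast_ediv_sub_le x hd, by ring⟩

theorem le_cast_ediv_add_one (x : ℤ) {d : ℤ} (hd : 0 < d) : (x : ℝ) / d ≤ ((x / d : ℤ) : ℝ) + 1 := by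
  have := abs_le.mp (abs_cast_ediv_sub_le x hd)
  linarith

/-- The value `y` is described by the model `a` at `s`. -/
def Lin.Rep (a : Lin) (s y : ℝ) : Prop :=
  ∃ r : ℝ, |r| ≤ a.e ∧ fixedOne * y = a.c + a.l * s + r

/-- The value `y` is described by the model `a` at `(s, t)`. -/
def Lin₂.Rep (a : Lin₂) (s t y : ℝ) : Prop :=
  ∃ r : ℝ, |r| ≤ a.e ∧ fixedOne * y = a.c + a.l * s + a.m * t + r

theorem Lin.mkForced_eq (c l e : ℤ) : Lin.mkForced c l e = ⟨c, l, e⟩ := by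
  simp only [Lin.mkForced, forceInt_eq]

theorem Lin₂.mkForced_eq (c l m e : ℤ) : Lin₂.mkForced c l m e = ⟨c, l, m, e⟩ := by
  simp only [Lin₂.mkForced, forceInt_eq]

namespace Lin.Rep

variable {a b : Lin} {s x y : ℝ}

theorem const {n e : ℤ} (h : |fixedOne * y - n| ≤ e) : (Lin.const n e).Rep s y :=
  ⟨fixedOne * y - n, h, by simp [Lin.const]⟩

theorem add (ha : a.Rep s x) (hb : b.Rep s y) : (a.add b).Rep s (x + y) := by
  obtain ⟨r, hr, ex⟩ := ha
  obtain ⟨q, hq, ey⟩ := hb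
  rw [Lin.add, Lin.mkForced_eq]
  refine ⟨r + q, ?_, ?_⟩
  · push_cast
    exact (abs_add_le r q).trans (add_le_add hr hq)
  · rw [mul_add, ex, ey]
    push_cast
    ring

theorem sub (ha : a.Rep s x) (hb : b.Rep s y) : (a.sub b).Rep s (x - y) := by
  obtain ⟨r, hr, ex⟩ := ha
  obtain ⟨q, hq, ey⟩ := hb
  rw [Lin.sub, Lin.mkForced_eq]
  refine ⟨r - q, ?_, ?_⟩
  · push_cast
    exact (abs_sub r q).trans (add_le_add hr hq)
  · rw [mul_sub, ex, ey]
    push_cast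
    ring

theorem scale (hs : |s| ≤ 1) {n d : ℕ} (hd : 0 < d) (ha : a.Rep s x) :
    (a.scale n d).Rep s (n / d * x) := by
  obtain ⟨r, hr, ex⟩ := ha
  have hd' : (0 : ℤ) < d := by exact_mod_cast hd
  have hd'' : (0 : ℝ) < d := by exact_mod_cast hd
  obtain ⟨r1, h1, e1⟩ := exists_cast_ediv_eq (n * a.c) hd'
  obtain ⟨r2, h2, e2⟩ := exists_cast_ediv_eq (n * a.l) hd'
  have h3 := le_cast_ediv_add_one (n * a.e) hd'
  rw [Lin.scale, Lin.mkForced_eq]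
  refine ⟨n / d * r - r1 - r2 * s, ?_, ?_⟩
  · have i1 : |(n / d : ℝ) * r| ≤ n * a.e / d := by
      rw [abs_mul, abs_of_nonneg (by positivity), div_mul_eq_mul_div]
      gcongr
    have i2 : |r2 * s| ≤ 1 := by
      rw [abs_mul]
      exact mul_le_one₀ h2 (abs_nonneg _) hs
    push_cast at h3 ⊢
    have := abs_sub (n / d * r - r1) (r2 * s)
    have := abs_sub (n / d * r) r1
    linarith
  · push_cast at e1 e2
    simp only [e1, e2]
    rw [mul_left_comm, ex]
    ring

theorem mul (hs : |s| ≤ 1) (ha : a.Rep s x) (hb : b.Rep s y) : (a.mul b).Rep s (x * y) := by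
  obtain ⟨r, hr, ex⟩ := ha
  obtain ⟨q, hq, ey⟩ := hb
  have hS : (0 : ℤ) < fixedOne := by norm_num
  have hS' := fixedOne_pos
  obtain ⟨r1, h1, e1⟩ := exists_cast_ediv_eq (a.c * b.c) hS
  obtain ⟨r2, h2, e2⟩ := exists_cast_ediv_eq (a.c * b.l + a.l * b.c) hS
  have h3 := le_cast_ediv_add_one (iabs a.l * iabs b.l + (iabs a.c + iabs a.l) * b.e +
    (iabs b.c + iabs b.l) * a.e + a.e * b.e) hS
  rw [Lin.mul, Lin.mkForced_eq]
  refine ⟨(a.l * b.l * s ^ 2 + (a.c + a.l * s) * q + (b.c + b.l * s) * r + r * q) / fixedOne -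
    r1 - r2 * s, ?_, ?_⟩
  · have ae : (0 : ℝ) ≤ a.e := (abs_nonneg _).trans hr
    have j1 : |(a.c : ℝ) + a.l * s| ≤ |(a.c : ℝ)| + |(a.l : ℝ)| := by
      refine (abs_add_le _ _).trans ?_
      rw [abs_mul]
      have := mul_le_of_le_one_right (abs_nonneg (a.l : ℝ)) hs
      linarith
    have j2 : |(b.c : ℝ) + b.l * s| ≤ |(b.c : ℝ)| + |(b.l : ℝ)| := by
      refine (abs_add_le _ _).trans ?_
      rw [abs_mul]
      have := mul_le_of_le_one_right (abs_nonneg (b.l : ℝ)) hs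
      linarith
    have k1 : |(a.l : ℝ) * b.l * s ^ 2| ≤ |(a.l : ℝ)| * |(b.l : ℝ)| := by
      rw [abs_mul, abs_mul, abs_pow]
      exact mul_le_of_le_one_right (by positivity) (pow_le_one₀ (abs_nonneg _) hs)
    have k2 : |((a.c : ℝ) + a.l * s) * q| ≤ (|(a.c : ℝ)| + |(a.l : ℝ)|) * b.e := by
      rw [abs_mul]
      gcongr
    have k3 : |((b.c : ℝ) + b.l * s) * r| ≤ (|(b.c : ℝ)| + |(b.l : ℝ)|) * a.e := by
      rw [abs_mul]
      gcongr
    have k4 : |r * q| ≤ a.e * b.e := by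
      rw [abs_mul]
      gcongr
    have i1 : |(a.l * b.l * s ^ 2 + (a.c + a.l * s) * q + (b.c + b.l * s) * r + r * q) /
        fixedOne| ≤ (|(a.l : ℝ)| * |(b.l : ℝ)| + (|(a.c : ℝ)| + |(a.l : ℝ)|) * b.e +
          (|(b.c : ℝ)| + |(b.l : ℝ)|) * a.e + a.e * b.e) / fixedOne := by
      rw [abs_div, abs_of_pos hS']
      gcongr
      exact (abs_add_le _ _).trans (add_le_add ((abs_add_le _ _).trans (add_le_add
        ((abs_add_le _ _).trans (add_le_add k1 k2)) k3)) k4)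
    have i2 : |r2 * s| ≤ 1 := by
      rw [abs_mul]
      exact mul_le_one₀ h2 (abs_nonneg _) hs
    simp only [Int.cast_add, Int.cast_mul, iabs_cast] at h3 ⊢
    have m1 := abs_sub ((a.l * b.l * s ^ 2 + (a.c + a.l * s) * q + (b.c + b.l * s) * r + r * q) /
      fixedOne - r1) (r2 * s)
    have m2 := abs_sub ((a.l * b.l * s ^ 2 + (a.c + a.l * s) * q + (b.c + b.l * s) * r + r * q) /
      fixedOne) r1
    push_cast at *
    linarith
  · have : fixedOne * (x * y) = (fixedOne * x) * (fixedOne * y) / fixedOne := by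
      field_simp
    rw [this, ex, ey]
    push_cast at e1 e2
    simp only [e1, e2]
    push_cast
    ring

end Lin.Rep

namespace Lin₂.Rep

variable {a b : Lin₂} {s t x y : ℝ}

theorem outerAdd {a b : Lin} (ha : a.Rep s x) (hb : b.Rep t y) :
    (outerAdd a b).Rep s t (x + y) := by
  obtain ⟨r, hr, ex⟩ := ha
  obtain ⟨q, hq, ey⟩ := hb
  rw [Lin₂.outerAdd, Lin₂.mkForced_eq]
  refine ⟨r + q, ?_, ?_⟩
  · push_cast
    exact (abs_add_le r q).trans (add_le_add hr hq)
  · rw [mul_add, ex, ey]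
    push_cast
    ring

theorem outerMul {a b : Lin} (hs : |s| ≤ 1) (ht : |t| ≤ 1) (ha : a.Rep s x) (hb : b.Rep t y) :
    (outerMul a b).Rep s t (x * y) := by
  obtain ⟨r, hr, ex⟩ := ha
  obtain ⟨q, hq, ey⟩ := hb
  have hS : (0 : ℤ) < fixedOne := by norm_num
  have hS' := fixedOne_pos
  obtain ⟨r1, h1, e1⟩ := exists_cast_ediv_eq (a.c * b.c) hS
  obtain ⟨r2, h2, e2⟩ := exists_cast_ediv_eq (a.l * b.c) hS
  obtain ⟨r3, h3, e3⟩ := exists_cast_ediv_eq (a.c * b.l) hS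
  have h4 := le_cast_ediv_add_one (iabs a.l * iabs b.l + (iabs a.c + iabs a.l) * b.e +
    (iabs b.c + iabs b.l) * a.e + a.e * b.e) hS
  rw [Lin₂.outerMul, Lin₂.mkForced_eq]
  refine ⟨(a.l * b.l * (s * t) + (a.c + a.l * s) * q + (b.c + b.l * t) * r + r * q) / fixedOne -
    r1 - r2 * s - r3 * t, ?_, ?_⟩
  · have ae : (0 : ℝ) ≤ a.e := (abs_nonneg _).trans hr
    have j1 : |(a.c : ℝ) + a.l * s| ≤ |(a.c : ℝ)| + |(a.l : ℝ)| := by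
      refine (abs_add_le _ _).trans ?_
      rw [abs_mul]
      have := mul_le_of_le_one_right (abs_nonneg (a.l : ℝ)) hs
      linarith
    have j2 : |(b.c : ℝ) + b.l * t| ≤ |(b.c : ℝ)| + |(b.l : ℝ)| := by
      refine (abs_add_le _ _).trans ?_
      rw [abs_mul]
      have := mul_le_of_le_one_right (abs_nonneg (b.l : ℝ)) ht
      linarith
    have k1 : |(a.l : ℝ) * b.l * (s * t)| ≤ |(a.l : ℝ)| * |(b.l : ℝ)| := by
      rw [abs_mul, abs_mul, abs_mul]
      exact mul_le_of_le_one_right (by positivity) (mul_le_one₀ hs (abs_nonneg _) ht)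
    have k2 : |((a.c : ℝ) + a.l * s) * q| ≤ (|(a.c : ℝ)| + |(a.l : ℝ)|) * b.e := by
      rw [abs_mul]
      gcongr
    have k3 : |((b.c : ℝ) + b.l * t) * r| ≤ (|(b.c : ℝ)| + |(b.l : ℝ)|) * a.e := by
      rw [abs_mul]
      gcongr
    have k4 : |r * q| ≤ a.e * b.e := by
      rw [abs_mul]
      gcongr
    have i1 : |(a.l * b.l * (s * t) + (a.c + a.l * s) * q + (b.c + b.l * t) * r + r * q) /
        fixedOne| ≤ (|(a.l : ℝ)| * |(b.l : ℝ)| + (|(a.c : ℝ)| + |(a.l : ℝ)|) * b.e +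
          (|(b.c : ℝ)| + |(b.l : ℝ)|) * a.e + a.e * b.e) / fixedOne := by
      rw [abs_div, abs_of_pos hS']
      gcongr
      exact (abs_add_le _ _).trans (add_le_add ((abs_add_le _ _).trans (add_le_add
        ((abs_add_le _ _).trans (add_le_add k1 k2)) k3)) k4)
    have i2 : |r2 * s| ≤ 1 := by
      rw [abs_mul]
      exact mul_le_one₀ h2 (abs_nonneg _) hs
    have i3 : |r3 * t| ≤ 1 := by
      rw [abs_mul]
      exact mul_le_one₀ h3 (abs_nonneg _) ht
    simp only [Int.cast_add, Int.cast_mul, iabs_cast] at h4 ⊢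
    have m0 := abs_sub ((a.l * b.l * (s * t) + (a.c + a.l * s) * q + (b.c + b.l * t) * r + r * q) /
      fixedOne - r1 - r2 * s) (r3 * t)
    have m1 := abs_sub ((a.l * b.l * (s * t) + (a.c + a.l * s) * q + (b.c + b.l * t) * r + r * q) /
      fixedOne - r1) (r2 * s)
    have m2 := abs_sub ((a.l * b.l * (s * t) + (a.c + a.l * s) * q + (b.c + b.l * t) * r + r * q) /
      fixedOne) r1
    push_cast at *
    linarith
  · have : fixedOne * (x * y) = (fixedOne * x) * (fixedOne * y) / fixedOne := by
      field_simp
    rw [this, ex, ey]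
    push_cast at e1 e2 e3
    simp only [e1, e2, e3]
    push_cast
    ring

theorem const {n e : ℤ} (h : |fixedOne * y - n| ≤ e) : (Lin₂.const n e).Rep s t y :=
  ⟨fixedOne * y - n, h, by simp [Lin₂.const]⟩

theorem add (ha : a.Rep s t x) (hb : b.Rep s t y) : (a.add b).Rep s t (x + y) := by
  obtain ⟨r, hr, ex⟩ := ha
  obtain ⟨q, hq, ey⟩ := hb
  rw [Lin₂.add, Lin₂.mkForced_eq]
  refine ⟨r + q, ?_, ?_⟩
  · push_cast
    exact (abs_add_le r q).trans (add_le_add hr hq)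
  · rw [mul_add, ex, ey]
    push_cast
    ring

theorem sub (ha : a.Rep s t x) (hb : b.Rep s t y) : (a.sub b).Rep s t (x - y) := by
  obtain ⟨r, hr, ex⟩ := ha
  obtain ⟨q, hq, ey⟩ := hb
  rw [Lin₂.sub, Lin₂.mkForced_eq]
  refine ⟨r - q, ?_, ?_⟩
  · push_cast
    exact (abs_sub r q).trans (add_le_add hr hq)
  · rw [mul_sub, ex, ey]
    push_cast
    ring

theorem scale (hs : |s| ≤ 1) (ht : |t| ≤ 1) {n d : ℕ} (hd : 0 < d) (ha : a.Rep s t x) :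
    (a.scale n d).Rep s t (n / d * x) := by
  obtain ⟨r, hr, ex⟩ := ha
  have hd' : (0 : ℤ) < d := by exact_mod_cast hd
  have hd'' : (0 : ℝ) < d := by exact_mod_cast hd
  obtain ⟨r1, h1, e1⟩ := exists_cast_ediv_eq (n * a.c) hd'
  obtain ⟨r2, h2, e2⟩ := exists_cast_ediv_eq (n * a.l) hd'
  obtain ⟨r3, h3, e3⟩ := exists_cast_ediv_eq (n * a.m) hd'
  have h4 := le_cast_ediv_add_one (n * a.e) hd'
  rw [Lin₂.scale, Lin₂.mkForced_eq]
  refine ⟨n / d * r - r1 - r2 * s - r3 * t, ?_, ?_⟩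
  · have i1 : |(n / d : ℝ) * r| ≤ n * a.e / d := by
      rw [abs_mul, abs_of_nonneg (by positivity), div_mul_eq_mul_div]
      gcongr
    have i2 : |r2 * s| ≤ 1 := by
      rw [abs_mul]
      exact mul_le_one₀ h2 (abs_nonneg _) hs
    have i3 : |r3 * t| ≤ 1 := by
      rw [abs_mul]
      exact mul_le_one₀ h3 (abs_nonneg _) ht
    push_cast at h4 ⊢
    have := abs_sub (n / d * r - r1 - r2 * s) (r3 * t)
    have := abs_sub (n / d * r - r1) (r2 * s)
    have := abs_sub (n / d * r) r1
    linarith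
  · push_cast at e1 e2 e3
    simp only [e1, e2, e3]
    rw [mul_left_comm, ex]
    ring

theorem lower_le (hs : |s| ≤ 1) (ht : |t| ≤ 1) (ha : a.Rep s t x) :
    (a.lower : ℝ) ≤ fixedOne * x := by
  obtain ⟨r, hr, ex⟩ := ha
  rw [ex, lower]
  simp only [Int.cast_sub, iabs_cast]
  have h1 : |(a.l : ℝ) * s| ≤ |(a.l : ℝ)| := by
    rw [abs_mul]
    exact mul_le_of_le_one_right (abs_nonneg _) hs
  have h2 : |(a.m : ℝ) * t| ≤ |(a.m : ℝ)| := by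
    rw [abs_mul]
    exact mul_le_of_le_one_right (abs_nonneg _) ht
  linarith [abs_le.mp h1, abs_le.mp h2, abs_le.mp hr]

theorem le_upper (hs : |s| ≤ 1) (ht : |t| ≤ 1) (ha : a.Rep s t x) :
    fixedOne * x ≤ (a.upper : ℝ) := by
  obtain ⟨r, hr, ex⟩ := ha
  rw [ex, upper]
  simp only [Int.cast_add, iabs_cast]
  have h1 : |(a.l : ℝ) * s| ≤ |(a.l : ℝ)| := by
    rw [abs_mul]
    exact mul_le_of_le_one_right (abs_nonneg _) hs
  have h2 : |(a.m : ℝ) * t| ≤ |(a.m : ℝ)| := by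
    rw [abs_mul]
    exact mul_le_of_le_one_right (abs_nonneg _) ht
  linarith [abs_le.mp h1, abs_le.mp h2, abs_le.mp hr]

end Lin₂.Rep

namespace Lin.Rep

variable {a b : Lin} {s x y : ℝ}

theorem abs_linear_add_le {l s r e : ℝ} (hs : |s| ≤ 1) (hr : |r| ≤ e) :
    |l * s + r| ≤ |l| + e := by
  refine (abs_add_le _ _).trans (add_le_add ?_ hr)
  rw [abs_mul]
  exact mul_le_of_le_one_right (abs_nonneg _) hs

/-- The error estimate that sine and cosine have in common: `f` and `g` are their values at the
midpoint, and `F` and `G` the fixed-point approximations. -/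
theorem of_second_order (hs : |s| ≤ 1) (ha : a.Rep s x) {F G : ℤ} {f g : ℝ} (hg : |g| ≤ 1)
    (hF : |(F : ℝ) - fixedOne * f| ≤ 2) (hG : |(G : ℝ) - fixedOne * g| ≤ 2) {L : ℤ}
    (hL : |(L : ℝ) - G * a.l / fixedOne| ≤ 1)
    (hy : |y - (f + g * (x - a.c / fixedOne))| ≤ (x - a.c / fixedOne) ^ 2 / 2) :
    (Lin.mk F L (a.e + ((iabs a.l + a.e) * (iabs a.l + a.e) + 4 * iabs a.l) / (2 * fixedOne) +
      5)).Rep s y := by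
  obtain ⟨r, hr, ex⟩ := ha
  have hS' := fixedOne_pos
  have hx : x - a.c / fixedOne = (a.l * s + r) / fixedOne := by
    rw [eq_div_iff hS'.ne', sub_mul, div_mul_cancel₀ _ hS'.ne']
    linarith
  rw [hx] at hy
  have h3 := le_cast_ediv_add_one ((iabs a.l + a.e) * (iabs a.l + a.e) + 4 * iabs a.l)
    (d := 2 * fixedOne) (by norm_num)
  have hd := abs_linear_add_le (l := (a.l : ℝ)) hs hr
  refine ⟨fixedOne * y - (F + L * s), ?_, by ring⟩
  have i1 : |fixedOne * (y - (f + g * ((a.l * s + r) / fixedOne)))| ≤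
      (|(a.l : ℝ)| + a.e) * (|(a.l : ℝ)| + a.e) / (2 * fixedOne) := by
    rw [abs_mul, abs_of_pos hS']
    refine (mul_le_mul_of_nonneg_left hy hS'.le).trans ?_
    rw [div_pow, ← sq_abs (a.l * s + r)]
    have := pow_le_pow_left₀ (abs_nonneg _) hd 2
    calc fixedOne * (|(a.l : ℝ) * s + r| ^ 2 / fixedOne ^ 2 / 2)
        = |(a.l : ℝ) * s + r| ^ 2 / (2 * fixedOne) := by field_simp
      _ ≤ (|(a.l : ℝ)| + a.e) ^ 2 / (2 * fixedOne) := by gcongr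
      _ = _ := by rw [sq]
  have i2 : |g * r| ≤ a.e := by
    rw [abs_mul]
    exact (mul_le_of_le_one_left (abs_nonneg _) hg).trans hr
  have i3 : |(G - fixedOne * g) * a.l / fixedOne * s| ≤ 4 * |(a.l : ℝ)| / (2 * fixedOne) := by
    rw [abs_mul, abs_div, abs_of_pos hS', abs_mul]
    refine (mul_le_of_le_one_right (by positivity) hs).trans ?_
    calc |(G : ℝ) - fixedOne * g| * |(a.l : ℝ)| / fixedOne ≤ 2 * |(a.l : ℝ)| / fixedOne := by gcongr
      _ = _ := by field_simp; ring
  have i4 : |(L - G * a.l / fixedOne) * s| ≤ 1 := by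
    rw [abs_mul]
    exact mul_le_one₀ hL (abs_nonneg _) hs
  -- The error splits into the second-order Taylor term, the error of the argument times the
  -- derivative, and the inaccuracies of `F`, `G` and `L`.
  have e : fixedOne * y - (F + L * s) = fixedOne * (y - (f + g * ((a.l * s + r) / fixedOne))) +
      g * r - (F - fixedOne * f) - (G - fixedOne * g) * a.l / fixedOne * s -
      (L - G * a.l / fixedOne) * s := by
    field_simp
    ring
  rw [e]
  simp only [Int.cast_add, Int.cast_mul, iabs_cast] at h3 ⊢
  rw [add_div] at h3
  push_cast at *
  rw [abs_le] at *
  constructor <;> linarith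

theorem of_abs_le_one (hy : |y| ≤ 1) : (Lin.mk 0 0 fixedOne).Rep s y := by
  refine ⟨fixedOne * y, ?_, by simp⟩
  rw [abs_mul, abs_of_pos fixedOne_pos]
  exact mul_le_of_le_one_right fixedOne_pos.le hy

theorem cos (hs : |s| ≤ 1) (ha : a.Rep s x) : a.cos.Rep s (Real.cos x) := by
  unfold Lin.cos
  split_ifs with h
  · have h' : |a.c| ≤ 4 * fixedOne := by rwa [iabs, Int.natCast_natAbs] at h
    rw [Lin.mkForced_eq]
    have h1 := abs_cast_ediv_sub_le (fixedSin a.c * a.l) (d := fixedOne) (by norm_num)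
    refine of_second_order hs ha (G := -fixedSin a.c) (f := Real.cos (a.c / fixedOne))
      (g := -Real.sin (a.c / fixedOne)) ?_ (abs_fixedCos_sub_le h') ?_ ?_ ?_
    · rw [abs_neg]
      exact Real.abs_sin_le_one _
    · have := abs_fixedSin_sub_le h'
      rw [← abs_neg]
      convert this using 2
      push_cast
      ring
    · rw [← abs_neg]
      convert h1 using 2
      push_cast
      ring
    · have := abs_cos_add_sub_le (a.c / fixedOne) (x - a.c / fixedOne)
      rw [add_sub_cancel] at this
      convert this using 2
      ring
  · exact of_abs_le_one (Real.abs_cos_le_one x)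

theorem sin (hs : |s| ≤ 1) (ha : a.Rep s x) : a.sin.Rep s (Real.sin x) := by
  unfold Lin.sin
  split_ifs with h
  · have h' : |a.c| ≤ 4 * fixedOne := by rwa [iabs, Int.natCast_natAbs] at h
    rw [Lin.mkForced_eq]
    have h1 := abs_cast_ediv_sub_le (fixedCos a.c * a.l) (d := fixedOne) (by norm_num)
    refine of_second_order hs ha (G := fixedCos a.c) (f := Real.sin (a.c / fixedOne))
      (g := Real.cos (a.c / fixedOne)) (Real.abs_cos_le_one _) (abs_fixedSin_sub_le h')
      (abs_fixedCos_sub_le h') ?_ ?_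
    · convert h1 using 2
      push_cast
      ring
    · have := abs_sin_add_sub_le (a.c / fixedOne) (x - a.c / fixedOne)
      rwa [add_sub_cancel] at this
  · exact of_abs_le_one (Real.abs_sin_le_one x)

theorem pos_of_lower (hs : |s| ≤ 1) (ha : a.Rep s x) (h : 0 < a.c - iabs a.l - a.e) : 0 < x := by
  obtain ⟨r, hr, ex⟩ := ha
  have hd := abs_le.mp (abs_linear_add_le (l := (a.l : ℝ)) hs hr)
  have h' : (0 : ℝ) < a.c - |(a.l : ℝ)| - a.e := by
    rw [← iabs_cast]
    exact_mod_cast h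
  have : 0 < fixedOne * x := by linarith
  exact pos_of_mul_pos_right this fixedOne_pos.le

theorem inv (hs : |s| ≤ 1) (ha : a.Rep s x) (h : 0 < a.c - iabs a.l - a.e) :
    a.inv.Rep s x⁻¹ := by
  have hx := ha.pos_of_lower hs h
  obtain ⟨r, hr, ex⟩ := ha
  have hS' := fixedOne_pos
  have hd := abs_linear_add_le (l := (a.l : ℝ)) hs hr
  have ae : (0 : ℝ) ≤ a.e := (abs_nonneg _).trans hr
  have h' : (0 : ℝ) < a.c - |(a.l : ℝ)| - a.e := by
    rw [← iabs_cast]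
    exact_mod_cast h
  have hc' : (0 : ℝ) < a.c := by linarith [abs_nonneg (a.l : ℝ)]
  have hc : 0 < a.c := by exact_mod_cast hc'
  obtain ⟨r1, h1, e1⟩ := exists_cast_ediv_eq (fixedOne * fixedOne) hc
  obtain ⟨r2, h2, e2⟩ := exists_cast_ediv_eq (fixedOne * fixedOne * a.l) (mul_pos hc hc)
  have h3 := le_cast_ediv_add_one (fixedOne * fixedOne * a.e) (mul_pos hc hc)
  have h4 := le_cast_ediv_add_one (fixedOne * fixedOne * (iabs a.l + a.e) * (iabs a.l + a.e))
    (mul_pos (mul_pos hc hc) h)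
  rw [Lin.inv, Lin.mkForced_eq]
  have i2 : |r2 * s| ≤ 1 := by
    rw [abs_mul]
    exact mul_le_one₀ h2 (abs_nonneg _) hs
  obtain ⟨δ, hδ⟩ : ∃ δ, δ = (a.l : ℝ) * s + r := ⟨_, rfl⟩
  rw [← hδ] at hd
  have hG : fixedOne * x = a.c + δ := by rw [ex, hδ]; ring
  have hGlow : (a.c : ℝ) - |(a.l : ℝ)| - a.e ≤ fixedOne * x := by
    rw [hG]
    linarith [abs_le.mp hd]
  have hG0 : 0 < fixedOne * x := by positivity
  have key : fixedOne * x⁻¹ = fixedOne * fixedOne / a.c - fixedOne * fixedOne * δ / (a.c * a.c) +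
      fixedOne * fixedOne * δ * δ / (a.c * a.c * (fixedOne * x)) := by
    have hδ' : δ = fixedOne * x - a.c := by linarith
    rw [hδ']
    field_simp
    ring
  have i3 : |fixedOne * fixedOne * r / (a.c * a.c)| ≤ fixedOne * fixedOne * a.e / (a.c * a.c) := by
    rw [abs_div, abs_mul, abs_of_pos (mul_pos hS' hS'), abs_of_pos (mul_pos hc' hc')]
    gcongr
  have i4 : |fixedOne * fixedOne * δ * δ / (a.c * a.c * (fixedOne * x))| ≤
      fixedOne * fixedOne * (|(a.l : ℝ)| + a.e) * (|(a.l : ℝ)| + a.e) /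
        (a.c * a.c * (a.c - |(a.l : ℝ)| - a.e)) := by
    rw [abs_div, abs_mul, abs_mul, abs_of_pos (mul_pos hS' hS'),
      abs_of_pos (mul_pos (mul_pos hc' hc') hG0)]
    gcongr
  refine ⟨fixedOne * fixedOne * δ * δ / (a.c * a.c * (fixedOne * x)) -
    fixedOne * fixedOne * r / (a.c * a.c) - r1 + r2 * s, ?_, ?_⟩
  · simp only [Int.cast_add, Int.cast_mul, Int.cast_sub, iabs_cast] at h3 h4 ⊢
    push_cast at *
    rw [abs_le] at *
    constructor <;> linarith
  · rw [key]
    push_cast at e1 e2 ⊢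
    rw [e1, e2, hδ]
    ring

end Lin.Rep

/-! ### Linear lower bounds for `arccos` -/

theorem cos_tangent_le {t θ : ℝ} (ht : t ∈ Set.Icc (Real.pi / 2) Real.pi)
    (hθ : θ ∈ Set.Icc (Real.pi / 2) Real.pi) :
    Real.cos t - Real.sin t * (θ - t) ≤ Real.cos θ := by
  have hc : ConvexOn ℝ (Set.Icc (Real.pi / 2) Real.pi) Real.cos := by
    refine convexOn_of_deriv2_nonneg (convex_Icc _ _) Real.continuous_cos.continuousOn
      Real.differentiable_cos.differentiableOn ?_ ?_
    · simp only [Real.deriv_cos']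
      exact Real.differentiable_sin.neg.differentiableOn
    · intro x hx
      rw [interior_Icc] at hx
      have : deriv^[2] Real.cos x = -Real.cos x := by simp
      rw [this]
      have := Real.cos_nonpos_of_pi_div_two_le_of_le hx.1.le (by linarith [hx.2, Real.pi_pos])
      linarith
  rcases lt_trichotomy t θ with h | h | h
  · have := hc.le_slope_of_hasDerivAt ht hθ h (Real.hasDerivAt_cos t)
    rw [slope_def_field, le_div_iff₀ (by linarith)] at this
    linarith
  · simp [h]
  · have := hc.slope_le_of_hasDerivAt hθ ht h (Real.hasDerivAt_cos t)
    rw [slope_def_field, div_le_iff₀ (by linarith)] at this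
    linarith

/-- On [π/2, π] cosine is convex, so an almost-tangent at t works, with a correction because n need
not equal 1/sin t. On [0, π/2] cosine lies above its chord, which reduces the claim to θ = 0, where
it reads m ≤ n, and to θ = π/2. -/
theorem line_le {t m n θ : ℝ} (ht : t ∈ Set.Icc (Real.pi / 2) Real.pi) (hn : 0 ≤ n) (hmn : m ≤ n)
    (h : m + 2 * |1 - n * Real.sin t| ≤ t + n * Real.cos t) (hθ : θ ∈ Set.Icc 0 Real.pi) :
    m ≤ θ + n * Real.cos θ := by
  have hpi := Real.pi_pos
  have hpi4 := Real.pi_le_four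
  have large : ∀ {θ}, θ ∈ Set.Icc (Real.pi / 2) Real.pi → m ≤ θ + n * Real.cos θ := by
    intro θ hθ
    have h1 := mul_le_mul_of_nonneg_left (cos_tangent_le ht hθ) hn
    -- Both angles lie in an interval of length π/2 ≤ 2; this is the factor 2 in the hypothesis.
    have h2 : |(1 - n * Real.sin t) * (θ - t)| ≤ |1 - n * Real.sin t| * 2 := by
      rw [abs_mul]
      gcongr
      rw [abs_le]
      constructor <;> linarith [ht.1, ht.2, hθ.1, hθ.2]
    linarith [(abs_le.mp h2).1]
  rcases le_total (Real.pi / 2) θ with h1 | h1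
  · exact large ⟨h1, hθ.2⟩
  · have h2 := large (θ := Real.pi / 2) ⟨le_rfl, by linarith⟩
    rw [Real.cos_pi_div_two, mul_zero, add_zero] at h2
    have h3 := mul_le_mul_of_nonneg_left (Real.one_sub_mul_le_cos hθ.1 h1) hn
    have h4 : 0 ≤ 2 / Real.pi * θ := mul_nonneg (by positivity) hθ.1
    have h5 : 2 / Real.pi * θ ≤ 1 := by
      rw [div_mul_eq_mul_div, div_le_one hpi]
      linarith
    have h6 : θ = 2 / Real.pi * θ * (Real.pi / 2) := by field_simp
    have h7 := mul_le_mul_of_nonneg_left h2 h4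
    have h8 := mul_le_mul_of_nonneg_left hmn (sub_nonneg.mpr h5)
    nlinarith

/-- A decidable certificate that a line, with coefficients in fixed-point arithmetic, lies below the
graph of `arccos`, which it almost touches at the angle `t`. -/
def Line.certified (t : ℤ) (k : Line) : Bool :=
  6746518853 ≤ t && t ≤ 13493037704 && k.m ≤ k.n &&
    -- The slack 6n absorbs the fixed-point errors: 2n from the cosine, and 4n from the sine, whose
    -- term carries the factor 2.
    k.m * fixedOne + 2 * iabs (fixedOne * fixedOne - k.n * fixedSin t) + 6 * k.n ≤
      t * fixedOne + k.n * fixedCos t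

/-- The line `k` lies below the graph of `arccos`. -/
def Line.Valid (k : Line) : Prop :=
  ∀ θ ∈ Set.Icc 0 Real.pi, (k.m / fixedOne : ℝ) ≤ θ + k.n / fixedOne * Real.cos θ

theorem Line.valid_of_certified {t : ℤ} {k : Line} (h : k.certified t = true) : k.Valid := by
  simp only [Line.certified, Bool.and_eq_true, decide_eq_true_eq] at h
  obtain ⟨⟨⟨h1, h2⟩, h3⟩, h4⟩ := h
  have hS := fixedOne_pos
  have h1' : (6746518853 : ℝ) ≤ t := by exact_mod_cast h1
  have h2' : (t : ℝ) ≤ 13493037704 := by exact_mod_cast h2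
  have h3' : (k.m : ℝ) ≤ k.n := by exact_mod_cast h3
  have h4' : (k.m * fixedOne + 2 * |(fixedOne * fixedOne - k.n * fixedSin t : ℝ)| + 6 * k.n : ℝ) ≤
      t * fixedOne + k.n * fixedCos t := by
    have := (Int.cast_le (R := ℝ)).mpr h4
    simpa only [Int.cast_add, Int.cast_mul, iabs_cast, Int.cast_sub, Int.cast_natCast,
      Int.cast_ofNat] using this
  have htt : |t| ≤ 4 * fixedOne :=
    (show |t| ≤ 17179869184 by rw [abs_le]; constructor <;> omega).trans (by norm_num)
  have hs := abs_le.mp (abs_fixedSin_sub_le htt)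
  have hc := abs_le.mp (abs_fixedCos_sub_le htt)
  have hn : (0 : ℝ) ≤ k.n := Nat.cast_nonneg _
  intro θ hθ
  refine line_le (t := t / fixedOne) ⟨?_, ?_⟩ (by positivity) (by gcongr) ?_ hθ
  · rw [le_div_iff₀ hS]
    have := Real.pi_lt_d20
    norm_num at this ⊢
    linarith
  · rw [div_le_iff₀ hS]
    have := Real.pi_gt_d20
    norm_num at this ⊢
    linarith
  · have e1 : (fixedOne : ℝ) * fixedOne * |1 - k.n / fixedOne * Real.sin (t / fixedOne)| =
        |(fixedOne * fixedOne - k.n * fixedSin t) +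
          k.n * (fixedSin t - fixedOne * Real.sin (t / fixedOne))| := by
      rw [← abs_of_pos (mul_pos hS hS), ← abs_mul, abs_of_pos (mul_pos hS hS)]
      congr 1
      field_simp
      ring
    have e2 := abs_add_le (fixedOne * fixedOne - k.n * fixedSin t : ℝ)
      (k.n * (fixedSin t - fixedOne * Real.sin (t / fixedOne)))
    have e3 : |(k.n : ℝ) * (fixedSin t - fixedOne * Real.sin (t / fixedOne))| ≤ k.n * 2 := by
      rw [abs_mul, abs_of_nonneg hn]
      exact mul_le_mul_of_nonneg_left (abs_fixedSin_sub_le htt) hn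
    have e4 : (k.n : ℝ) * fixedCos t ≤ k.n * (fixedOne * Real.cos (t / fixedOne)) + k.n * 2 := by
      have := mul_le_mul_of_nonneg_left hc.2 hn
      linarith
    have key : fixedOne * fixedOne * (k.m / fixedOne +
        2 * |1 - k.n / fixedOne * Real.sin (t / fixedOne)|) ≤ fixedOne * fixedOne *
        ((t : ℝ) / fixedOne + k.n / fixedOne * Real.cos (t / fixedOne)) := by
      have g1 : (fixedOne : ℝ) * fixedOne * (k.m / fixedOne) = k.m * fixedOne := by field_simp
      have g2 : (fixedOne : ℝ) * fixedOne * (t / fixedOne + k.n / fixedOne *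
          Real.cos (t / fixedOne)) = t * fixedOne +
          k.n * (fixedOne * Real.cos (t / fixedOne)) := by field_simp
      rw [mul_add, g1, g2, mul_left_comm, e1]
      generalize |(fixedOne * fixedOne - k.n * fixedSin t : ℝ) +
          k.n * (fixedSin t - fixedOne * Real.sin (t / fixedOne))| = X at *
      generalize |(fixedOne * fixedOne - k.n * fixedSin t : ℝ)| = Y at *
      generalize |(k.n : ℝ) * (fixedSin t - fixedOne * Real.sin (t / fixedOne))| = Z at *
      generalize (k.n : ℝ) * (fixedOne * Real.cos (t / fixedOne)) = W at *
      linarith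
    exact le_of_mul_le_mul_left key (mul_pos hS hS)

/-- The certifying angle is about 2.3311, where θ/(1 - cos θ) attains its minimum κ ≈ 1.38, so that
the line through (1, 0) is nearly tangent there. -/
theorem kappaLine_valid : kappaLine.Valid :=
  Line.valid_of_certified (t := 10012092750) (by decide +kernel)

theorem mul_arccos_le {n c : ℝ} (hn : n ≤ 5927054868 / fixedOne) (hc : c ∈ Set.Icc (-1) 1) :
    n * (1 - c) ≤ Real.arccos c := by
  have h := kappaLine_valid (Real.arccos c) ⟨Real.arccos_nonneg c, Real.arccos_le_pi c⟩
  rw [Real.cos_arccos hc.1 hc.2] at h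
  have h1 := mul_le_mul_of_nonneg_right hn (sub_nonneg.mpr hc.2)
  simp only [kappaLine] at h
  push_cast at h h1
  linarith

/-- The angle is 2.33, just below the minimizer of θ/(1 - cos θ), and the cosine bound is -0.688.
Thus c ≥ -0.688 forces arccos c into the range where that quotient decreases. -/
theorem cos_sin_upper_angle : Real.cos (10007273799 / fixedOne) ≤ -2954937500 / fixedOne ∧
    1 ≤ 10007273799 / fixedOne * Real.sin (10007273799 / fixedOne) +
      Real.cos (10007273799 / fixedOne) := by
  have h1 : (10007273799 : ℤ) ≤ 4 * fixedOne := by norm_num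
  have hs := abs_fixedSin_sub_le (x := 10007273799) (by norm_num)
  have hc := abs_fixedCos_sub_le (x := 10007273799) (by norm_num)
  have es : fixedSin 10007273799 = 3115502221 := by decide +kernel
  have ec : fixedCos 10007273799 = -2956415056 := by decide +kernel
  rw [es] at hs
  rw [ec] at hc
  rw [abs_le] at hs hc
  push_cast at *
  constructor <;> linarith

/-- The function has derivative x cos x, so it increases from the value 1 up to π/2 and then
decreases; the value at the right end is still at least 1. The inequality gives the sign of the
derivative of (1 - cos x)/x. -/
theorem one_le_mul_sin_add_cos {θ : ℝ} (h0 : 0 ≤ θ) (h1 : θ ≤ 10007273799 / fixedOne) :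
    1 ≤ θ * Real.sin θ + Real.cos θ := by
  have hd : ∀ x, HasDerivAt (fun x => x * Real.sin x + Real.cos x) (x * Real.cos x) x := by
    intro x
    refine (((hasDerivAt_id x).mul (Real.hasDerivAt_sin x)).add
      (Real.hasDerivAt_cos x)).congr_deriv ?_
    simp
  have hcont : Continuous fun x : ℝ => x * Real.sin x + Real.cos x := by fun_prop
  have hpi := Real.pi_pos
  rcases le_total θ (Real.pi / 2) with h | h
  · have : MonotoneOn (fun x => x * Real.sin x + Real.cos x) (Set.Icc 0 (Real.pi / 2)) := by
      refine monotoneOn_of_deriv_nonneg (convex_Icc _ _) hcont.continuousOn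
        (fun x _ => (hd x).differentiableAt.differentiableWithinAt) fun x hx => ?_
      rw [interior_Icc] at hx
      rw [(hd x).deriv]
      exact mul_nonneg hx.1.le (Real.cos_nonneg_of_mem_Icc ⟨by linarith [hx.1], hx.2.le⟩)
    simpa using this ⟨le_rfl, by positivity⟩ ⟨h0, h⟩ h0
  · have hb : (10007273799 / fixedOne : ℝ) ≤ Real.pi := by
      have := Real.pi_gt_three
      push_cast
      linarith
    have : AntitoneOn (fun x => x * Real.sin x + Real.cos x) (Set.Icc (Real.pi / 2) Real.pi) := by
      refine antitoneOn_of_deriv_nonpos (convex_Icc _ _) hcont.continuousOn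
        (fun x _ => (hd x).differentiableAt.differentiableWithinAt) fun x hx => ?_
      rw [interior_Icc] at hx
      rw [(hd x).deriv]
      exact mul_nonpos_of_nonneg_of_nonpos (by linarith [hx.1])
        (Real.cos_nonpos_of_pi_div_two_le_of_le hx.1.le (by linarith [hx.2]))
    exact cos_sin_upper_angle.2.trans (this ⟨h, h1.trans hb⟩ ⟨h.trans h1, hb⟩ h1)

/-- The graph of `arccos` lies above the chord to `(1, 0)`. -/
theorem mul_one_sub_cos_le {θ Θ : ℝ} (h0 : 0 ≤ θ) (h : θ ≤ Θ)
    (h1 : Θ ≤ 10007273799 / fixedOne) : Θ * (1 - Real.cos θ) ≤ θ * (1 - Real.cos Θ) := by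
  rcases h0.eq_or_lt with rfl | h0
  · simp
  have hd : ∀ x : ℝ, 0 < x → HasDerivAt (fun x => (1 - Real.cos x) / x)
      ((x * Real.sin x + Real.cos x - 1) / x ^ 2) x := by
    intro x hx
    refine (((Real.hasDerivAt_cos x).const_sub 1).div (hasDerivAt_id x) hx.ne').congr_deriv ?_
    simp
    ring
  have hm : MonotoneOn (fun x => (1 - Real.cos x) / x) (Set.Icc θ Θ) := by
    refine monotoneOn_of_deriv_nonneg (convex_Icc _ _)
      (fun x hx => (hd x (h0.trans_le hx.1)).continuousAt.continuousWithinAt)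
      (fun x hx => ?_) fun x hx => ?_
    · rw [interior_Icc] at hx
      exact (hd x (h0.trans hx.1)).differentiableAt.differentiableWithinAt
    · rw [interior_Icc] at hx
      rw [(hd x (h0.trans hx.1)).deriv]
      have := one_le_mul_sin_add_cos (h0.trans hx.1).le (hx.2.le.trans h1)
      exact div_nonneg (by linarith) (sq_nonneg x)
  have := hm ⟨le_rfl, h⟩ ⟨h, le_rfl⟩ h
  simp only at this
  rw [div_le_div_iff₀ h0 (h0.trans_le h)] at this
  linarith

/-! ### The edge inequality on a pair of cells -/

/-- The rotated angle, for the parameter of the main theorem. -/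
noncomputable def rot (a : ℝ) : ℝ := rotAngle 0.209 a

/-- The part of the edge inequality that depends on one angle. -/
noncomputable def edgeBase (a : ℝ) : ℝ :=
  0.586 * rot a + 0.2646376 * (Real.pi * Real.cos a) - 0.5839188 * Real.pi

/-- On the face `z = -1 - cos a - cos b` of the triangle inequalities, the edge inequality says that
the angle between the rotated vectors is at least `facePhase a + facePhase b`. -/
noncomputable def facePhase (a : ℝ) : ℝ :=
  4516 / 7070 * (Real.pi * (1 + 207 / 500 * Real.cos a)) - 293 / 707 * rot a

/-- The component `sin (rot a) cot (a / 2)`. -/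
noncomputable def rotCot (a : ℝ) : ℝ :=
  Real.sin (rot a) * (Real.cos (a / 2) * (Real.sin (a / 2))⁻¹)

/-- The models of `k` describe the functions of the angle `a` at `s`. -/
structure Cell.Rep (k : Cell) (s a : ℝ) : Prop where
  abs_le_one : |s| ≤ 1
  angle : fixedOne * a = k.mid + k.rad * s
  rad_nonneg : 0 ≤ k.rad
  cosA : k.cosA.Rep s (Real.cos a)
  sinA : k.sinA.Rep s (Real.sin a)
  cosR : k.cosR.Rep s (Real.cos (rot a))
  sinR : k.sinR.Rep s (Real.sin (rot a))
  half : k.half.Rep s (Real.sin (a / 2))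
  cotR : 0 < k.half.c - iabs k.half.l - k.half.e → k.cotR.Rep s (rotCot a)
  phi : k.phi.Rep s (facePhase a)
  cosP : k.cosP.Rep s (Real.cos (facePhase a))
  sinP : k.sinP.Rep s (Real.sin (facePhase a))
  piCos : k.piCos.Rep s (0.6385624 * (Real.pi * Real.cos a))
  piSin : k.piSin.Rep s (0.6385624 * (Real.pi * Real.sin a))
  base : k.base.Rep s (edgeBase a)
  faceBase : k.faceBase.Rep s
    (edgeBase a - 0.6385624 * (Real.pi * Real.cos a) - 0.3192812 * Real.pi)

theorem Cell.Rep.le {k : Cell} {s a : ℝ} (h : k.Rep s a) : fixedOne * a ≤ k.mid + k.rad := by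
  have : (k.rad : ℝ) * s ≤ k.rad * 1 := mul_le_mul_of_nonneg_left
    (abs_le.mp h.abs_le_one).2 (by exact_mod_cast h.rad_nonneg)
  rw [h.angle]
  linarith

theorem linPi_rep (s : ℝ) : linPi.Rep s Real.pi := by
  refine Lin.Rep.const ?_
  have h1 := Real.pi_gt_d20
  have h2 := Real.pi_lt_d20
  norm_num at h1 h2 ⊢
  rw [abs_le]
  constructor <;> linarith

theorem mkCell_rep {mid rad : ℤ} {s a : ℝ} (hs : |s| ≤ 1) (hrad : 0 ≤ rad)
    (h : fixedOne * a = mid + rad * s) :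
    (mkCell mid rad).Rep s a := by
  have ha : (Lin.mkForced mid rad 0).Rep s a := by
    rw [Lin.mkForced_eq]
    exact ⟨0, by simp, by simpa using h⟩
  have hone : (Lin.const fixedOne 0).Rep s 1 := Lin.Rep.const (by simp)
  have hpi := linPi_rep s
  have hx := ha.cos hs
  have hA := (ha.scale hs (n := 791) (d := 1000) (by norm_num)).add
    ((hpi.mul hs (hone.sub hx)).scale hs (n := 209) (d := 2000) (by norm_num))
  rw [show ((791 : ℕ) : ℝ) / (1000 : ℕ) * a + ((209 : ℕ) : ℝ) / (2000 : ℕ) *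
    (Real.pi * (1 - Real.cos a)) = rot a by rw [rot, rotAngle]; push_cast; ring] at hA
  have hh := ha.scale hs (n := 1) (d := 2) (by norm_num)
  rw [show ((1 : ℕ) : ℝ) / (2 : ℕ) * a = a / 2 by push_cast; ring] at hh
  have hP := ((hpi.mul hs (hone.add (hx.scale hs (n := 207) (d := 500) (by norm_num)))).scale hs
    (n := 4516) (d := 7070) (by norm_num)).sub (hA.scale hs (n := 293) (d := 707) (by norm_num))
  rw [show ((4516 : ℕ) : ℝ) / (7070 : ℕ) * (Real.pi * (1 + ((207 : ℕ) : ℝ) / (500 : ℕ) *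
    Real.cos a)) - ((293 : ℕ) : ℝ) / (707 : ℕ) * rot a = facePhase a by
      rw [facePhase]; push_cast; ring] at hP
  have hB := ((hA.scale hs (n := 293) (d := 500) (by norm_num)).add ((hpi.mul hs hx).scale hs
    (n := 2646376) (d := 10000000) (by norm_num))).sub
      (hpi.scale hs (n := 5839188) (d := 10000000) (by norm_num))
  rw [show ((293 : ℕ) : ℝ) / (500 : ℕ) * rot a + ((2646376 : ℕ) : ℝ) / (10000000 : ℕ) *
    (Real.pi * Real.cos a) - ((5839188 : ℕ) : ℝ) / (10000000 : ℕ) * Real.pi = edgeBase a by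
      rw [edgeBase]; push_cast; ring] at hB
  have hpx := (hpi.mul hs hx).scale hs (n := 6385624) (d := 10000000) (by norm_num)
  rw [show ((6385624 : ℕ) : ℝ) / (10000000 : ℕ) * (Real.pi * Real.cos a) =
    0.6385624 * (Real.pi * Real.cos a) by push_cast; ring] at hpx
  have hps := (hpi.mul hs (ha.sin hs)).scale hs (n := 6385624) (d := 10000000) (by norm_num)
  rw [show ((6385624 : ℕ) : ℝ) / (10000000 : ℕ) * (Real.pi * Real.sin a) =
    0.6385624 * (Real.pi * Real.sin a) by push_cast; ring] at hps
  have hF := (hB.sub hpx).sub (hpi.scale hs (n := 3192812) (d := 10000000) (by norm_num))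
  rw [show ((3192812 : ℕ) : ℝ) / (10000000 : ℕ) * Real.pi = 0.3192812 * Real.pi by
    push_cast; ring] at hF
  exact ⟨hs, h, hrad, hx, ha.sin hs, hA.cos hs, hA.sin hs, hh.sin hs,
    fun h0 => (hA.sin hs).mul hs ((hh.cos hs).mul hs ((hh.sin hs).inv hs h0)), hP, hP.cos hs,
    hP.sin hs, hpx, hps, hB, hF⟩

/-! ### The edge inequality -/

/-- The edge inequality for the angles `a`, `b` with `v₀` says that this is non-negative at the
cosines `c` and `z` of the angles between the two vectors after and before rotation. -/
noncomputable def edgeGap (a b c z : ℝ) : ℝ :=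
  edgeBase a + edgeBase b + 1.414 * Real.arccos c + 0.6385624 * Real.pi * z

/-- The gap with `arccos c` replaced by `m - n c`. -/
noncomputable def lineGap (m n a b c z : ℝ) : ℝ :=
  edgeBase a + edgeBase b + 1.414 * (m - n * c) + 0.6385624 * Real.pi * z

theorem lineGap_le_edgeGap {k : Line} (hk : k.Valid) {a b c z : ℝ} (hc : c ∈ Set.Icc (-1) 1) :
    lineGap (k.m / fixedOne) (k.n / fixedOne) a b c z ≤ edgeGap a b c z := by
  have := hk (Real.arccos c) ⟨Real.arccos_nonneg c, Real.arccos_le_pi c⟩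
  rw [Real.cos_arccos hc.1 hc.2] at this
  rw [lineGap, edgeGap]
  linarith

/-- `lineGap` is affine along the segment that is described by the dihedral cosine `k`. -/
theorem lineGap_nonneg_of_endpoints {m n a b c₀ z₀ c₁ z₁ t : ℝ} (ht : t ∈ Set.Icc 0 1)
    (h0 : 0 ≤ lineGap m n a b c₀ z₀) (h1 : 0 ≤ lineGap m n a b c₁ z₁) :
    0 ≤ lineGap m n a b ((1 - t) * c₀ + t * c₁) ((1 - t) * z₀ + t * z₁) := by
  have e : lineGap m n a b ((1 - t) * c₀ + t * c₁) ((1 - t) * z₀ + t * z₁) =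
      (1 - t) * lineGap m n a b c₀ z₀ + t * lineGap m n a b c₁ z₁ := by
    simp only [lineGap]
    ring
  rw [e]
  exact add_nonneg (mul_nonneg (sub_nonneg.mpr ht.2) h0) (mul_nonneg ht.1 h1)

theorem lineGap_nonneg_of_checkLine {k : Line} {base c : Lin₂} {s t a b c' z base' : ℝ}
    (hs : |s| ≤ 1) (ht : |t| ≤ 1) (hb : base.Rep s t base') (hc : c.Rep s t c')
    (hbase : base' = edgeBase a + edgeBase b + 0.6385624 * Real.pi * z)
    (h : checkLine base c k = true) :
    0 ≤ lineGap (k.m / fixedOne) (k.n / fixedOne) a b c' z := by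
  have hS := fixedOne_pos
  rw [checkLine, decide_eq_true_eq] at h
  have hm : (Lin₂.const (1414 * k.m / 1000) 1).Rep s t (1.414 * (k.m / fixedOne)) := by
    refine Lin₂.Rep.const ?_
    have := abs_cast_ediv_sub_le (1414 * k.m) (d := 1000) (by norm_num)
    rw [abs_sub_comm]
    convert this using 2
    · push_cast
      field_simp
      ring
    · norm_num
  have hn := hc.scale hs ht (n := 1414 * k.n) (d := 1000 * 4294967296) (by norm_num)
  have := ((hb.add hm).sub hn).lower_le hs ht
  have h' : (0 : ℝ) ≤ _ := (Int.cast_nonneg (R := ℝ) h).trans this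
  have e : (fixedOne : ℝ) * lineGap (k.m / fixedOne) (k.n / fixedOne) a b c' z = fixedOne *
      (base' + 1.414 * (k.m / fixedOne) -
        ((1414 * k.n : ℕ) : ℝ) / ((1000 * 4294967296 : ℕ) : ℝ) * c') := by
    rw [hbase, lineGap]
    push_cast
    ring
  rw [← e] at h'
  exact nonneg_of_mul_nonneg_right h' hS

/-- The edge inequality near the corner where both angles are small. -/
theorem edgeGap_nonneg_of_add_le {a b c z : ℝ} (ha : 0 ≤ a) (hb : 0 ≤ b) (hab : a + b ≤ 0.3)
    (hz : Real.cos (a + b) ≤ z) : 0 ≤ edgeGap a b c z := by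
  have h1 := Real.one_sub_sq_div_two_le_cos (x := a)
  have h2 := Real.one_sub_sq_div_two_le_cos (x := b)
  have h3 := Real.one_sub_sq_div_two_le_cos (x := a + b)
  have h4 := Real.arccos_nonneg c
  have hpi := Real.pi_pos
  have hpi' := Real.pi_lt_d2
  have hr : ∀ x, 0 ≤ x → 0.791 * x ≤ rot x := by
    intro x _
    have := mul_nonneg (mul_nonneg (by norm_num : (0 : ℝ) ≤ 0.209) hpi.le)
      (sub_nonneg.mpr (Real.cos_le_one x))
    rw [rot, rotAngle]
    linarith
  have h5 := hr a ha
  have h6 := hr b hb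
  -- By 1 - cos x ≤ x²/2 and z ≥ cos(a + b) the loss is quadratic, with constant (0.2646376 +
  -- 0.6385624)/2 = 0.4516. For a + b ≤ 0.3 it is at most 3.15 · 0.4516 · 0.3 (a + b) < 0.427 (a +
  -- b), below the gain 0.586 · 0.791 (a + b) from the rotated angles.
  have h7 : Real.pi * (0.2646376 * (1 - Real.cos a) + 0.2646376 * (1 - Real.cos b) +
      0.6385624 * (1 - z)) ≤ 3.15 * (0.4516 * (a + b) ^ 2) := by
    have h8 : 0.2646376 * (1 - Real.cos a) + 0.2646376 * (1 - Real.cos b) +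
        0.6385624 * (1 - z) ≤ 0.4516 * (a + b) ^ 2 := by nlinarith [mul_nonneg ha hb]
    refine (mul_le_mul_of_nonneg_left h8 hpi.le).trans ?_
    gcongr
  have h8 : (a + b) ^ 2 ≤ 0.3 * (a + b) := by nlinarith
  rw [edgeGap, edgeBase, edgeBase]
  nlinarith

theorem affine_eq {k k₀ p q : ℝ} (hk₀ : k₀ < 1) : p + k * q =
    (1 - (k - k₀) / (1 - k₀)) * (p + k₀ * q) + (k - k₀) / (1 - k₀) * (p + 1 * q) := by
  have : 1 - k₀ ≠ 0 := by linarith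
  field_simp
  ring

theorem lineGap_nonneg_of_le {m n a b p q p' q' k k₀ : ℝ} (hk₀ : k₀ < 1) (h : k₀ ≤ k) (h1 : k ≤ 1)
    (h2 : 0 ≤ lineGap m n a b (p + k₀ * q) (p' + k₀ * q'))
    (h3 : 0 ≤ lineGap m n a b (p + 1 * q) (p' + 1 * q')) :
    0 ≤ lineGap m n a b (p + k * q) (p' + k * q') := by
  rw [affine_eq hk₀ (p := p), affine_eq hk₀ (p := p')]
  refine lineGap_nonneg_of_endpoints ⟨div_nonneg ?_ ?_, ?_⟩ h2 h3
  · linarith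
  · linarith
  · rw [div_le_one] <;> linarith

theorem sin_mul_cot_half {a : ℝ} (h : Real.sin (a / 2) ≠ 0) :
    Real.sin a * (Real.cos (a / 2) * (Real.sin (a / 2))⁻¹) = 1 + Real.cos a := by
  have h1 : Real.sin a = 2 * Real.sin (a / 2) * Real.cos (a / 2) := by
    rw [← Real.sin_two_mul]
    ring_nf
  have h2 : Real.cos a = 2 * Real.cos (a / 2) ^ 2 - 1 := by
    rw [← Real.cos_two_mul]
    ring_nf
  rw [h1, h2]
  field_simp
  ring

theorem edgeGap_face (a b c : ℝ) : edgeGap a b c (-1 - Real.cos a - Real.cos b) =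
    1.414 * (Real.arccos c - (facePhase a + facePhase b)) := by
  rw [edgeGap, edgeBase, edgeBase, facePhase, facePhase]
  ring

/-- The part of the edge inequality in which the angle between the rotated vectors is bounded by the
chord that starts on the face of the triangle inequalities. -/
theorem edgeGap_nonneg_of_chord {a b p q p' q' k k₀ : ℝ} (hq : 0 ≤ q) (hk₀ : k₀ ≤ 0)
    (h : k₀ ≤ k) (h1 : k ≤ 1) (hpq : p + 1 * q ≤ 1)
    (hlow : -2954937500 / fixedOne ≤ p + k₀ * q)
    (hface : 0 ≤ edgeGap a b (p + k₀ * q) (p' + k₀ * q'))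
    (hone : 0 ≤ lineGap (kappaLine.m / fixedOne) (kappaLine.n / fixedOne) a b
      (p + 1 * q) (p' + 1 * q')) :
    0 ≤ edgeGap a b (p + k * q) (p' + k * q') := by
  have hkq : k * q ≤ 1 * q := mul_le_mul_of_nonneg_right h1 hq
  have hkq₀ : k₀ * q ≤ k * q := mul_le_mul_of_nonneg_right h hq
  have hk0q : k₀ * q ≤ 0 := mul_nonpos_of_nonpos_of_nonneg hk₀ hq
  have hl : (-1 : ℝ) ≤ -2954937500 / fixedOne := by norm_num
  obtain ⟨Θ, hΘ⟩ : ∃ Θ, Θ = Real.arccos (p + k₀ * q) := ⟨_, rfl⟩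
  have hcos : Real.cos Θ = p + k₀ * q := by rw [hΘ, Real.cos_arccos] <;> linarith
  have hΘ0 : 0 ≤ Θ := hΘ ▸ Real.arccos_nonneg _
  have hΘpi : Θ ≤ Real.pi := hΘ ▸ Real.arccos_le_pi _
  have hΘ1 : Θ ≤ 10007273799 / fixedOne := by
    by_contra hcon
    have := Real.cos_lt_cos_of_nonneg_of_le_pi (by norm_num) hΘpi (not_le.mp hcon)
    linarith [cos_sin_upper_angle.1]
  -- Here n is the slope Θ/(1 - cos Θ), up to sign, of the chord from (cos Θ, Θ) to (1, 0). For Θ =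
  -- 0 the chord degenerates and κ takes its place.
  obtain ⟨n, hn1, hn2, hn3⟩ : ∃ n : ℝ, 5927054868 / fixedOne ≤ n ∧ n * (1 - Real.cos Θ) = Θ ∧
      ∀ c, p + k₀ * q ≤ c → c ≤ 1 → n * (1 - c) ≤ Real.arccos c := by
    rcases hΘ0.eq_or_lt with h0 | h0
    · refine ⟨5927054868 / fixedOne, le_rfl, by simp [← h0], fun c hc hc1 => ?_⟩
      exact mul_arccos_le le_rfl ⟨by linarith, hc1⟩
    · have hlt : 0 < 1 - Real.cos Θ := by
        have := Real.cos_lt_cos_of_nonneg_of_le_pi le_rfl hΘpi h0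
        rw [Real.cos_zero] at this
        linarith
      refine ⟨Θ / (1 - Real.cos Θ), ?_, div_mul_cancel₀ _ hlt.ne', fun c hc hc1 => ?_⟩
      · rw [le_div_iff₀ hlt, hcos, hΘ]
        exact mul_arccos_le le_rfl ⟨by linarith, by linarith⟩
      · have h2 := mul_one_sub_cos_le (Real.arccos_nonneg c)
          (by rw [hΘ]; exact Real.arccos_le_arccos hc) hΘ1
        rw [Real.cos_arccos (by linarith) hc1] at h2
        rw [div_mul_eq_mul_div, div_le_iff₀ hlt]
        exact h2
  -- At k₀ the chord meets arccos, so the gap there is that of `hface`. At k = 1 the chord lies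
  -- above the line of κ, because n ≥ κ and c ≤ 1.
  have hg : 0 ≤ lineGap n n a b (p + k * q) (p' + k * q') := by
    refine lineGap_nonneg_of_le (by linarith) h h1 ?_ ?_
    · refine hface.trans_eq ?_
      rw [edgeGap, lineGap, ← hΘ, ← hcos]
      linear_combination 1.414 * (-1) * hn2
    · refine hone.trans ?_
      have := mul_le_mul_of_nonneg_right hn1 (sub_nonneg.mpr hpq)
      rw [lineGap, lineGap, kappaLine]
      push_cast at this ⊢
      linarith
  refine hg.trans ?_
  have := hn3 (p + k * q) (by linarith) (by linarith)
  rw [edgeGap, lineGap]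
  linarith

/-- If the sum of the phases is in [0, π], then cos(phase sum) ≥ c is equivalent to the claim, as
arccos is antitone; a non-positive sum needs no argument. -/
theorem arccos_nonneg_of_checkFace {ka kb : Cell} {cf : Lin₂} {s t a b c : ℝ} (ha : ka.Rep s a)
    (hb : kb.Rep t b) (hc : cf.Rep s t c) (h : checkFace cf ka kb = true) :
    -2954937500 / fixedOne ≤ c ∧ facePhase a + facePhase b ≤ Real.arccos c := by
  have hs := ha.abs_le_one
  have ht := hb.abs_le_one
  have hS := fixedOne_pos
  simp only [checkFace, Bool.and_eq_true, Bool.or_eq_true, decide_eq_true_eq] at h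
  obtain ⟨h1, h2⟩ := h
  have hup := (Lin₂.Rep.outerAdd ha.phi hb.phi).le_upper hs ht
  constructor
  · rw [div_le_iff₀ hS, mul_comm]
    refine le_trans ?_ (hc.lower_le hs ht)
    exact_mod_cast h1
  · rcases h2 with h2 | ⟨h2, h3⟩
    · have h2' : ((Lin₂.outerAdd ka.phi kb.phi).upper : ℝ) ≤ 0 := by exact_mod_cast h2
      refine le_trans ?_ (Real.arccos_nonneg c)
      exact nonpos_of_mul_nonpos_right (hup.trans h2') hS
    · have h2' : ((Lin₂.outerAdd ka.phi kb.phi).upper : ℝ) ≤ 13493037703 := by exact_mod_cast h2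
      have hpi : facePhase a + facePhase b ≤ Real.pi := by
        have h4 := Real.pi_gt_d20
        have h5 := hup.trans h2'
        norm_num at h4 h5
        linarith
      have h6 := ((((Lin₂.Rep.outerMul hs ht ha.cosP hb.cosP).sub
        (Lin₂.Rep.outerMul hs ht ha.sinP hb.sinP)).sub hc).lower_le hs ht)
      have h3' : (0 : ℝ) ≤ _ := (Int.cast_nonneg (R := ℝ) h3).trans h6
      have h7 := nonneg_of_mul_nonneg_right h3' hS
      rw [← Real.cos_add] at h7
      rcases le_total 0 (facePhase a + facePhase b) with h8 | h8
      · rw [← Real.arccos_cos h8 hpi]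
        exact Real.arccos_le_arccos (by linarith)
      · exact h8.trans (Real.arccos_nonneg c)

/-- Soundness of `checkPair`: the models certify the gap at the ends of the range of k, and affinity
in k does the rest. The lower end may be the face value only because `hface` keeps k above it. -/
theorem edgeGap_nonneg_of_checkPair {L : List Line} (hL : ∀ l ∈ L, l.Valid) {ka kb : Cell}
    {s t a b k : ℝ} (ha : ka.Rep s a) (hb : kb.Rep t b) (h : checkPair L ka kb = true)
    (ha0 : a ∈ Set.Icc 0 Real.pi) (hb0 : b ∈ Set.Icc 0 Real.pi) (hk : k ∈ Set.Icc (-1) 1)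
    (hface : 0 < a → 0 < b → -(Real.cos (a / 2) * (Real.sin (a / 2))⁻¹ *
      (Real.cos (b / 2) * (Real.sin (b / 2))⁻¹)) ≤ k) :
    0 ≤ edgeGap a b
      (Real.cos (rot a) * Real.cos (rot b) + k * (Real.sin (rot a) * Real.sin (rot b)))
      (Real.cos a * Real.cos b + k * (Real.sin a * Real.sin b)) := by
  have hs := ha.abs_le_one
  have ht := hb.abs_le_one
  have hS := fixedOne_pos
  have hγ : (0.209 : ℝ) ∈ Set.Icc (0 : ℝ) 1 := by norm_num
  have hra := rotAngle_mem hγ ha0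
  have hrb := rotAngle_mem hγ hb0
  have hww : 0 ≤ Real.sin (rot a) * Real.sin (rot b) :=
    mul_nonneg (Real.sin_nonneg_of_mem_Icc hra) (Real.sin_nonneg_of_mem_Icc hrb)
  have hss : 0 ≤ Real.sin a * Real.sin b :=
    mul_nonneg (Real.sin_nonneg_of_mem_Icc ha0) (Real.sin_nonneg_of_mem_Icc hb0)
  have hkw := mul_le_mul_of_nonneg_right hk.1 hww
  have hkw' := mul_le_mul_of_nonneg_right hk.2 hww
  have hks := mul_le_mul_of_nonneg_right hk.1 hss
  have hC1 := Real.cos_le_one (rot a - rot b)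
  have hC2 := Real.neg_one_le_cos (rot a + rot b)
  rw [Real.cos_sub] at hC1
  rw [Real.cos_add] at hC2
  have hc : Real.cos (rot a) * Real.cos (rot b) + k * (Real.sin (rot a) * Real.sin (rot b)) ∈
      Set.Icc (-1) 1 := ⟨by linarith, by linarith⟩
  -- the models of the two-variable functions
  have hB := Lin₂.Rep.outerAdd ha.base hb.base
  have huu := Lin₂.Rep.outerMul hs ht ha.cosR hb.cosR
  have hwwR := Lin₂.Rep.outerMul hs ht ha.sinR hb.sinR
  have hxx := Lin₂.Rep.outerMul hs ht ha.piCos hb.cosA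
  have hssR := Lin₂.Rep.outerMul hs ht ha.piSin hb.sinA
  have hF := Lin₂.Rep.outerAdd ha.faceBase hb.faceBase
  have upper : ∀ l : Line, checkLine ((Lin₂.outerAdd ka.base kb.base).add
      ((Lin₂.outerMul ka.piCos kb.cosA).add (Lin₂.outerMul ka.piSin kb.sinA)))
      ((Lin₂.outerMul ka.cosR kb.cosR).add (Lin₂.outerMul ka.sinR kb.sinR)) l = true →
      0 ≤ lineGap (l.m / fixedOne) (l.n / fixedOne) a b
        (Real.cos (rot a) * Real.cos (rot b) + 1 * (Real.sin (rot a) * Real.sin (rot b)))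
        (Real.cos a * Real.cos b + 1 * (Real.sin a * Real.sin b)) := by
    intro l hl
    rw [one_mul, one_mul]
    exact lineGap_nonneg_of_checkLine hs ht (hB.add (hxx.add hssR)) (huu.add hwwR) (by ring) hl
  simp only [checkPair, Bool.or_eq_true, Bool.and_eq_true, decide_eq_true_eq, List.any_eq_true]
    at h
  -- The witness is k₀ = -cot(a/2) cot(b/2). Since sin a cot(a/2) = 1 + cos a, the value of z there
  -- is cos a cos b - (1 + cos a)(1 + cos b).
  have face : (0 < ka.half.c - iabs ka.half.l - ka.half.e ∧
      (0 < kb.half.c - iabs kb.half.l - kb.half.e ∧ 12025908428 ≤ ka.mid + kb.mid)) →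
      ∃ k₀ ≤ 0, k₀ ≤ k ∧ ((Lin₂.outerMul ka.cosR kb.cosR).sub
        (Lin₂.outerMul ka.cotR kb.cotR)).Rep s t (Real.cos (rot a) * Real.cos (rot b) +
          k₀ * (Real.sin (rot a) * Real.sin (rot b))) ∧
        Real.cos a * Real.cos b + k₀ * (Real.sin a * Real.sin b) =
          -1 - Real.cos a - Real.cos b := by
    rintro ⟨h1, h2, -⟩
    have hpa := ha.half.pos_of_lower hs h1
    have hpb := hb.half.pos_of_lower ht h2
    have ha1 : 0 < a := by
      rcases ha0.1.eq_or_lt with h0 | h0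
      · simp [← h0] at hpa
      · exact h0
    have hb1 : 0 < b := by
      rcases hb0.1.eq_or_lt with h0 | h0
      · simp [← h0] at hpb
      · exact h0
    refine ⟨_, ?_, hface ha1 hb1, ?_, ?_⟩
    · have hca := Real.cos_nonneg_of_mem_Icc (x := a / 2) ⟨by linarith [Real.pi_pos], by linarith [ha0.2]⟩
      have hcb := Real.cos_nonneg_of_mem_Icc (x := b / 2) ⟨by linarith [Real.pi_pos], by linarith [hb0.2]⟩
      rw [neg_nonpos]
      positivity
    · convert huu.sub (Lin₂.Rep.outerMul hs ht (ha.cotR h1) (hb.cotR h2)) using 1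
      rw [rotCot, rotCot]
      ring
    · have ea := sin_mul_cot_half hpa.ne'
      have eb := sin_mul_cot_half hpb.ne'
      calc _ = Real.cos a * Real.cos b - (Real.sin a * (Real.cos (a / 2) * (Real.sin (a / 2))⁻¹)) *
            (Real.sin b * (Real.cos (b / 2) * (Real.sin (b / 2))⁻¹)) := by ring
        _ = _ := by rw [ea, eb]; ring
  rcases h with h | ⟨hf, h1, h2⟩ | ⟨l, hl, h1, h2⟩
  · have hab : fixedOne * (a + b) ≤ 1288490188 := by
      have h' : (ka.mid + ka.rad + kb.mid + kb.rad : ℝ) ≤ 1288490188 := by exact_mod_cast h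
      linarith [ha.le, hb.le]
    refine edgeGap_nonneg_of_add_le ha0.1 hb0.1 ?_ ?_
    · norm_num at hab ⊢
      linarith
    · rw [Real.cos_add]
      linarith
  · obtain ⟨k₀, hk₀, hk₀k, hcf, hz⟩ := face hf
    obtain ⟨h3, h4⟩ := arccos_nonneg_of_checkFace ha hb hcf h2
    refine edgeGap_nonneg_of_chord hww hk₀ hk₀k hk.2 (by linarith) h3 ?_ (upper _ h1)
    rw [hz, edgeGap_face]
    exact mul_nonneg (by norm_num) (sub_nonneg.mpr h4)
  · refine le_trans ?_ (lineGap_le_edgeGap (hL l hl) hc)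
    rcases h2 with h2 | ⟨hf, h2⟩
    · refine lineGap_nonneg_of_le (k₀ := -1) (by norm_num) hk.1 hk.2 ?_ (upper l h1)
      rw [neg_one_mul, neg_one_mul, ← sub_eq_add_neg, ← sub_eq_add_neg]
      exact lineGap_nonneg_of_checkLine hs ht (hB.add (hxx.sub hssR)) (huu.sub hwwR) (by ring) h2
    · obtain ⟨k₀, hk₀, hk₀k, hcf, hz⟩ := face hf
      refine lineGap_nonneg_of_le (by linarith) hk₀k hk.2 ?_ (upper l h1)
      rw [hz]
      exact lineGap_nonneg_of_checkLine hs ht hF hcf (by ring) h2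

/-! ### Subdivision of the square of angles -/

theorem mem_halves {mid rad : ℤ} {x : ℝ} (h : |x - mid| ≤ rad) :
    |x - (mid - (rad + 1) / 2 : ℤ)| ≤ ((rad + 1) / 2 : ℤ) ∨
      |x - (mid + (rad + 1) / 2 : ℤ)| ≤ ((rad + 1) / 2 : ℤ) := by
  have h1 : rad ≤ 2 * ((rad + 1) / 2) := by omega
  have h2 : (rad : ℝ) ≤ 2 * ((rad + 1) / 2 : ℤ) := by exact_mod_cast h1
  generalize ((rad + 1) / 2 : ℤ) = r at *
  push_cast
  rw [abs_le] at h
  rw [abs_le, abs_le]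
  rcases le_total x mid with hx | hx
  · exact Or.inl ⟨by linarith, by linarith⟩
  · exact Or.inr ⟨by linarith, by linarith⟩

theorem exists_mkCell_rep {mid rad : ℤ} {a : ℝ} (h : |fixedOne * a - mid| ≤ rad) :
    ∃ s, (mkCell mid rad).Rep s a := by
  have h0 : (0 : ℝ) ≤ rad := (abs_nonneg _).trans h
  rcases h0.eq_or_lt with h0 | h0
  · refine ⟨0, mkCell_rep (by simp) (by exact_mod_cast h0.le) ?_⟩
    rw [← h0, abs_nonpos_iff] at h
    linarith
  · refine ⟨(fixedOne * a - mid) / rad, mkCell_rep ?_ (by exact_mod_cast h0.le) ?_⟩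
    · rwa [abs_div, abs_of_pos h0, div_le_one h0]
    · field_simp
      ring

theorem mkTree_succ (n : ℕ) (mid rad : ℤ) : mkTree (n + 1) mid rad =
    .node (mkCell mid rad) (mkTree n (mid - (rad + 1) / 2) ((rad + 1) / 2))
      (mkTree n (mid + (rad + 1) / 2) ((rad + 1) / 2)) := by
  rw [mkTree]
  simp only [forceInt_eq]

variable {L : List Line} {P : ℝ → ℝ → Prop}

theorem of_checkPairs
    (hP : ∀ ka kb s t a b, ka.Rep s a → kb.Rep t b → checkPair L ka kb = true → P a b)
    (n : ℕ) {m r m' r' : ℤ} {a b : ℝ} (h : checkPairs L (mkTree n m r) (mkTree n m' r') = true)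
    (ha : |fixedOne * a - m| ≤ r) (hb : |fixedOne * b - m'| ≤ r') : P a b := by
  induction n generalizing m r m' r' with
  | zero => simp [mkTree, checkPairs] at h
  | succ n ih =>
    rw [mkTree_succ, mkTree_succ, checkPairs] at h
    simp only [Bool.or_eq_true, Bool.and_eq_true] at h
    rcases h with h | ⟨h1, h2, h3, h4⟩
    · obtain ⟨s, hs⟩ := exists_mkCell_rep ha
      obtain ⟨t, ht⟩ := exists_mkCell_rep hb
      exact hP _ _ _ _ _ _ hs ht h
    · rcases mem_halves ha with ha | ha <;> rcases mem_halves hb with hb | hb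
      · exact ih h1 ha hb
      · exact ih h2 ha hb
      · exact ih h3 ha hb
      · exact ih h4 ha hb

theorem of_checkDiag
    (hP : ∀ ka kb s t a b, ka.Rep s a → kb.Rep t b → checkPair L ka kb = true → P a b)
    (hsymm : ∀ a b, P a b → P b a) (n : ℕ) {m r : ℤ} {a b : ℝ}
    (h : checkDiag L (mkTree n m r) = true)
    (ha : |fixedOne * a - m| ≤ r) (hb : |fixedOne * b - m| ≤ r) : P a b := by
  induction n generalizing m r with
  | zero => simp [mkTree, checkDiag] at h
  | succ n ih =>
    rw [mkTree_succ, checkDiag] at h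
    simp only [Bool.or_eq_true, Bool.and_eq_true] at h
    rcases h with h | ⟨h1, h2, h3⟩
    · obtain ⟨s, hs⟩ := exists_mkCell_rep ha
      obtain ⟨t, ht⟩ := exists_mkCell_rep hb
      exact hP _ _ _ _ _ _ hs ht h
    · rcases mem_halves ha with ha | ha <;> rcases mem_halves hb with hb | hb
      · exact ih h1 ha hb
      · exact hsymm _ _ (of_checkPairs hP n h3 hb ha)
      · exact of_checkPairs hP n h3 ha hb
      · exact ih h2 ha hb

theorem lines_valid : ∀ l ∈ lines, l.Valid := by
  have h : (lineAngles.all fun t => (mkLine t).certified t) = true := by decide +kernel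
  rw [List.all_eq_true] at h
  intro l hl
  rw [lines, List.mem_cons] at hl
  rcases hl with rfl | hl
  · exact kappaLine_valid
  · obtain ⟨t, ht, rfl⟩ := List.mem_map.mp hl
    exact Line.valid_of_certified (h t ht)

/-- The root interval is [0, 2 · 6746537984] in fixed point, slightly longer than [0, π]. As
6746537984 = 3217 · 2^21, the nine halvings between the ten levels are exact. -/
theorem checkDiag_lines : checkDiag lines (mkTree 10 6746537984 6746537984) = true := by
  decide +kernel

/-- The edge inequality. -/
theorem edgeGap_nonneg {a b k : ℝ} (ha : a ∈ Set.Icc 0 Real.pi) (hb : b ∈ Set.Icc 0 Real.pi)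
    (hk : k ∈ Set.Icc (-1) 1) (hface : 0 < a → 0 < b → -(Real.cos (a / 2) * (Real.sin (a / 2))⁻¹ *
      (Real.cos (b / 2) * (Real.sin (b / 2))⁻¹)) ≤ k) :
    0 ≤ edgeGap a b
      (Real.cos (rot a) * Real.cos (rot b) + k * (Real.sin (rot a) * Real.sin (rot b)))
      (Real.cos a * Real.cos b + k * (Real.sin a * Real.sin b)) := by
  have hmem : ∀ x ∈ Set.Icc 0 Real.pi,
      |fixedOne * x - (6746537984 : ℤ)| ≤ (6746537984 : ℤ) := by
    intro x hx
    have := hx.2.trans Real.pi_lt_d20.le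
    push_cast
    norm_num at this
    rw [abs_le]
    constructor <;> linarith [hx.1]
  refine of_checkDiag (P := fun a b => a ∈ Set.Icc 0 Real.pi → b ∈ Set.Icc 0 Real.pi →
    (0 < a → 0 < b → -(Real.cos (a / 2) * (Real.sin (a / 2))⁻¹ *
      (Real.cos (b / 2) * (Real.sin (b / 2))⁻¹)) ≤ k) → 0 ≤ edgeGap a b
      (Real.cos (rot a) * Real.cos (rot b) + k * (Real.sin (rot a) * Real.sin (rot b)))
      (Real.cos a * Real.cos b + k * (Real.sin a * Real.sin b)))
    (fun ka kb s t a b ha hb h ha0 hb0 hf =>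
      edgeGap_nonneg_of_checkPair lines_valid ha hb h ha0 hb0 hk hf) (fun a b h hb0 ha0 hf => ?_)
    10 checkDiag_lines (hmem a ha) (hmem b hb) ha hb hface
  have := h ha0 hb0 fun h1 h2 => by rw [mul_comm (Real.cos (a / 2) * _)]; exact hf h2 h1
  rw [edgeGap] at this ⊢
  rw [mul_comm (Real.cos (rot b)), mul_comm (Real.sin (rot b)), mul_comm (Real.cos b),
    mul_comm (Real.sin b)]
  linarith

/-! ### The edge and loop inequalities for vectors -/

section Vectors

variable {E : Type*} [NormedAddCommGroup E] [InnerProductSpace ℝ E]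

theorem inner_orthPart_orthPart {x₀ : E} (h₀ : ‖x₀‖ = 1) (x y : E) :
    ⟪orthPart x₀ x, orthPart x₀ y⟫ = ⟪x, y⟫ - ⟪x₀, x⟫ * ⟪x₀, y⟫ := by
  simp only [orthPart, inner_sub_left, inner_sub_right, inner_smul_left, inner_smul_right,
    real_inner_self_eq_norm_sq, h₀, real_inner_comm x₀ x, conj_trivial]
  ring

theorem inner_rotate_rotate (γ : ℝ) {x₀ : E} (h₀ : ‖x₀‖ = 1) (x y : E) :
    ⟪rotate γ x₀ x, rotate γ x₀ y⟫ =
      Real.cos (rotAngle γ (Real.arccos ⟪x₀, x⟫)) * Real.cos (rotAngle γ (Real.arccos ⟪x₀, y⟫)) +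
      ⟪orthPart x₀ x, orthPart x₀ y⟫ * ‖orthPart x₀ x‖⁻¹ * ‖orthPart x₀ y‖⁻¹ *
        (Real.sin (rotAngle γ (Real.arccos ⟪x₀, x⟫)) *
          Real.sin (rotAngle γ (Real.arccos ⟪x₀, y⟫))) := by
  have h1 := inner_orthPart h₀ x
  have h2 := inner_orthPart h₀ y
  rw [real_inner_comm] at h1
  simp only [rotate, inner_add_left, inner_add_right, inner_smul_left, inner_smul_right, h1, h2,
    real_inner_self_eq_norm_sq, h₀, conj_trivial]
  ring

theorem norm_orthPart {x₀ x : E} (h₀ : ‖x₀‖ = 1) (h : ‖x‖ = 1) :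
    ‖orthPart x₀ x‖ = Real.sin (Real.arccos ⟪x₀, x⟫) := by
  rw [Real.sin_arccos, norm_eq_sqrt_real_inner, inner_orthPart_orthPart h₀,
    real_inner_self_eq_norm_sq, h]
  ring_nf

theorem sin_rotAngle_eq_zero {γ θ : ℝ} (hθ : θ ∈ Set.Icc 0 Real.pi) (h : Real.sin θ = 0) :
    Real.sin (rotAngle γ θ) = 0 := by
  rcases hθ.1.eq_or_lt with h0 | h0
  · simp [← h0, rotAngle]
  · rcases hθ.2.eq_or_lt with h1 | h1
    · rw [rotAngle, h1, Real.cos_pi, show (1 - γ) * Real.pi + γ * Real.pi * (1 - -1) / 2 = Real.pi by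
        ring, Real.sin_pi]
    · exact absurd h (Real.sin_pos_of_pos_of_lt_pi h0 h1).ne'

theorem cos_half_mul_inv_sin_half_nonneg {a : ℝ} (ha : a ∈ Set.Icc 0 Real.pi) :
    0 ≤ Real.cos (a / 2) * (Real.sin (a / 2))⁻¹ :=
  mul_nonneg
    (Real.cos_nonneg_of_mem_Icc ⟨by linarith [ha.1, Real.pi_pos], by linarith [ha.2]⟩)
    (inv_nonneg.mpr (Real.sin_nonneg_of_mem_Icc
      ⟨by linarith [ha.1], by linarith [ha.2, Real.pi_pos]⟩))

/-- The edge inequality for two vectors that satisfy a triangle inequality with `x₀`. -/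
theorem edgeGap_inner_nonneg {x₀ x y : E} (h₀ : ‖x₀‖ = 1) (hx : ‖x‖ = 1) (hy : ‖y‖ = 1)
    (h : -1 ≤ ⟪x, y⟫ + ⟪x₀, x⟫ + ⟪x₀, y⟫) :
    0 ≤ edgeGap (Real.arccos ⟪x₀, x⟫) (Real.arccos ⟪x₀, y⟫)
      ⟪rotate 0.209 x₀ x, rotate 0.209 x₀ y⟫ ⟪x, y⟫ := by
  obtain ⟨a, ha⟩ : ∃ a, a = Real.arccos ⟪x₀, x⟫ := ⟨_, rfl⟩
  obtain ⟨b, hb⟩ : ∃ b, b = Real.arccos ⟪x₀, y⟫ := ⟨_, rfl⟩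
  have ha0 : a ∈ Set.Icc 0 Real.pi := ha ▸ ⟨Real.arccos_nonneg _, Real.arccos_le_pi _⟩
  have hb0 : b ∈ Set.Icc 0 Real.pi := hb ▸ ⟨Real.arccos_nonneg _, Real.arccos_le_pi _⟩
  have hna := norm_orthPart h₀ hx
  have hnb := norm_orthPart h₀ hy
  have hza := inner_orthPart_orthPart h₀ x y
  have hrot := inner_rotate_rotate 0.209 h₀ x y
  have hbx := abs_le.mp ((abs_real_inner_le_norm x₀ x).trans (by rw [h₀, hx, one_mul]))
  have hby := abs_le.mp ((abs_real_inner_le_norm x₀ y).trans (by rw [h₀, hy, one_mul]))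
  have hca : Real.cos a = ⟪x₀, x⟫ := by rw [ha, Real.cos_arccos hbx.1 hbx.2]
  have hcb : Real.cos b = ⟪x₀, y⟫ := by rw [hb, Real.cos_arccos hby.1 hby.2]
  rw [← ha] at hna hrot ⊢
  rw [← hb] at hnb hrot ⊢
  rw [← hca, ← hcb] at hza h
  change _ = Real.cos (rot a) * Real.cos (rot b) + _ * (Real.sin (rot a) * Real.sin (rot b)) at hrot
  have hcs := abs_le.mp (abs_real_inner_le_norm (orthPart x₀ x) (orthPart x₀ y))
  rw [hna, hnb] at hcs
  have hz : ⟪x, y⟫ = Real.cos a * Real.cos b + ⟪orthPart x₀ x, orthPart x₀ y⟫ := by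
    rw [hza]
    ring
  have hsa := Real.sin_nonneg_of_mem_Icc ha0
  have hsb := Real.sin_nonneg_of_mem_Icc hb0
  -- If one of the vectors is ±x₀, the dihedral angle is undefined, but then neither cosine depends
  -- on k and k = 1 is admissible.
  by_cases hs : Real.sin a * Real.sin b = 0
  · have hr : Real.sin (rot a) * Real.sin (rot b) = 0 := by
      rcases mul_eq_zero.mp hs with h1 | h1
      · rw [rot, sin_rotAngle_eq_zero ha0 h1, zero_mul]
      · rw [rot, rot, sin_rotAngle_eq_zero hb0 h1, mul_zero]
    have hz0 : ⟪orthPart x₀ x, orthPart x₀ y⟫ = 0 := by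
      rw [hs] at hcs
      linarith
    have := edgeGap_nonneg (k := 1) ha0 hb0 (by norm_num) fun _ _ => by
      have := mul_nonneg (cos_half_mul_inv_sin_half_nonneg ha0)
        (cos_half_mul_inv_sin_half_nonneg hb0)
      linarith
    rw [hr, hs] at this
    rw [hrot, hz, hr, hz0]
    simpa using this
  · have hs0 : 0 < Real.sin a * Real.sin b := lt_of_le_of_ne (mul_nonneg hsa hsb) (Ne.symm hs)
    obtain ⟨k, hk⟩ : ∃ k, k = ⟪orthPart x₀ x, orthPart x₀ y⟫ / (Real.sin a * Real.sin b) := ⟨_, rfl⟩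
    have hk1 : ⟪orthPart x₀ x, orthPart x₀ y⟫ = k * (Real.sin a * Real.sin b) := by
      rw [hk, div_mul_cancel₀ _ hs]
    have hk2 : ⟪orthPart x₀ x, orthPart x₀ y⟫ * ‖orthPart x₀ x‖⁻¹ * ‖orthPart x₀ y‖⁻¹ = k := by
      rw [hk, hna, hnb, div_eq_mul_inv, mul_inv, mul_assoc]
    rw [hk2] at hrot
    rw [hrot, hz, hk1]
    refine edgeGap_nonneg ha0 hb0 ⟨?_, ?_⟩ fun ha1 hb1 => ?_
    · rw [hk, le_div_iff₀ hs0]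
      linarith
    · rw [hk, div_le_iff₀ hs0]
      linarith
    · have ea := sin_mul_cot_half (a := a)
        (Real.sin_pos_of_pos_of_lt_pi (by linarith) (by linarith [ha0.2])).ne'
      have eb := sin_mul_cot_half (a := b)
        (Real.sin_pos_of_pos_of_lt_pi (by linarith) (by linarith [hb0.2])).ne'
      refine le_of_mul_le_mul_right ?_ hs0
      rw [← hk1, hza]
      have e : -(Real.cos (a / 2) * (Real.sin (a / 2))⁻¹ * (Real.cos (b / 2) *
          (Real.sin (b / 2))⁻¹)) * (Real.sin a * Real.sin b) =
          -((Real.sin a * (Real.cos (a / 2) * (Real.sin (a / 2))⁻¹)) *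
            (Real.sin b * (Real.cos (b / 2) * (Real.sin (b / 2))⁻¹))) := by ring
      rw [e, ea, eb]
      linarith

/-- The inequality for loops. -/
theorem le_rotAngle {a : ℝ} (ha : a ∈ Set.Icc 0 Real.pi) :
    0.4516 * Real.pi * (1 - Real.cos a) ≤ rotAngle 0.209 a := by
  -- For equal vectors c = z = 1, and the gap is 1.172 times the difference of the two sides of the
  -- loop inequality.
  have := edgeGap_nonneg (k := 1) ha ha (by norm_num) fun _ _ => by
    have := mul_nonneg (cos_half_mul_inv_sin_half_nonneg ha)
      (cos_half_mul_inv_sin_half_nonneg ha)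
    linarith
  have h1 := Real.sin_sq_add_cos_sq (rot a)
  have h2 := Real.sin_sq_add_cos_sq a
  rw [show Real.cos (rot a) * Real.cos (rot a) + 1 * (Real.sin (rot a) * Real.sin (rot a)) = 1 by
    linarith, show Real.cos a * Real.cos a + 1 * (Real.sin a * Real.sin a) = 1 by linarith,
    edgeGap, Real.arccos_one, edgeBase, rot] at this
  linarith

end Vectors

/-! ### Hyperplanes separating two vectors -/

section Hyperplane

theorem sgn_of_nonneg {x : ℝ} (h : 0 ≤ x) : sgn x = 1 := if_pos h

theorem sgn_of_neg {x : ℝ} (h : x < 0) : sgn x = -1 := if_neg h.not_ge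

theorem sgn_mul_of_pos {c : ℝ} (hc : 0 < c) (x : ℝ) : sgn (c * x) = sgn x := by
  simp only [sgn, mul_nonneg_iff_of_pos_left hc]

theorem measurable_sgn : Measurable sgn :=
  Measurable.ite measurableSet_Ici measurable_const measurable_const

/-- Two directions at angle `θ` are separated by a line of a random direction with probability at
least `θ / π`. -/
theorem le_volume_sgn_cos_ne {θ : ℝ} (h0 : 0 ≤ θ) (hpi : θ ≤ Real.pi) (β : ℝ) :
    ENNReal.ofReal (2 * θ) ≤ volume ({t : ℝ | sgn (Real.cos (t - β)) ≠ sgn (Real.cos (t + θ - β))} ∩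
      Set.Ioc 0 (0 + 2 * Real.pi)) := by
  have hp := Real.pi_pos
  -- The period is shifted to start at c, so that the two intervals of separation, (c, c + θ) and (c
  -- + π, c + π + θ), do not wrap around.
  obtain ⟨c, hc⟩ : ∃ c, c = Real.pi / 2 - θ + β := ⟨_, rfl⟩
  obtain ⟨A, hA⟩ : ∃ A, A = {t : ℝ | sgn (Real.cos (t - β)) ≠ sgn (Real.cos (t + θ - β))} := ⟨_, rfl⟩
  have hm : MeasurableSet A := by
    rw [hA]
    refine (measurableSet_eq_fun ?_ ?_).compl
    · exact measurable_sgn.comp (by fun_prop)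
    · exact measurable_sgn.comp (by fun_prop)
  have hinv : ∀ g : AddSubgroup.zmultiples (2 * Real.pi), (fun x : ℝ => g +ᵥ x) ⁻¹' A = A := by
    rw [hA]
    rintro ⟨g, hg⟩
    obtain ⟨n, rfl⟩ := AddSubgroup.mem_zmultiples_iff.mp hg
    ext t
    simp only [Set.mem_preimage, Set.mem_ofPred_eq, AddSubgroup.mk_vadd, vadd_eq_add]
    rw [show n • (2 * Real.pi) + t - β = t - β + n * (2 * Real.pi) by rw [zsmul_eq_mul]; ring,
      show n • (2 * Real.pi) + t + θ - β = t + θ - β + n * (2 * Real.pi) by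
        rw [zsmul_eq_mul]; ring, Real.cos_add_int_mul_two_pi, Real.cos_add_int_mul_two_pi]
  rw [← hA, IsAddFundamentalDomain.measure_set_eq
    (isAddFundamentalDomain_Ioc Real.two_pi_pos 0 volume)
    (isAddFundamentalDomain_Ioc Real.two_pi_pos c volume) hm hinv, hA]
  have h1 : Set.Ioo c (c + θ) ∪ Set.Ioo (c + Real.pi) (c + Real.pi + θ) ⊆
      {t : ℝ | sgn (Real.cos (t - β)) ≠ sgn (Real.cos (t + θ - β))} ∩
        Set.Ioc c (c + 2 * Real.pi) := by
    rintro t (⟨ht1, ht2⟩ | ⟨ht1, ht2⟩)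
    · refine ⟨?_, ht1, by linarith⟩
      have i1 : 0 ≤ Real.cos (t - β) :=
        Real.cos_nonneg_of_mem_Icc ⟨by linarith, by linarith⟩
      have i2 : Real.cos (t + θ - β) < 0 :=
        Real.cos_neg_of_pi_div_two_lt_of_lt (by linarith) (by linarith)
      rw [Set.mem_ofPred_eq, sgn_of_nonneg i1, sgn_of_neg i2]
      decide
    · refine ⟨?_, by linarith, by linarith⟩
      have i1 : Real.cos (t - β) < 0 :=
        Real.cos_neg_of_pi_div_two_lt_of_lt (by linarith) (by linarith)
      have i2 : 0 ≤ Real.cos (t + θ - β) := by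
        rw [← Real.cos_sub_two_pi]
        exact Real.cos_nonneg_of_mem_Icc ⟨by linarith, by linarith⟩
      rw [Set.mem_ofPred_eq, sgn_of_neg i1, sgn_of_nonneg i2]
      decide
  refine le_trans ?_ (measure_mono h1)
  rw [measure_union _ measurableSet_Ioo, Real.volume_Ioo, Real.volume_Ioo,
    ← ENNReal.ofReal_add (by linarith) (by linarith)]
  · apply ENNReal.ofReal_le_ofReal
    linarith
  · rw [Set.disjoint_left]
    intro t h1 h2
    linarith [h1.2, h2.1]

/-- In polar coordinates for (p, q), both expressions are a positive multiple of a shifted cosine.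
-/
theorem le_volume_sgn_ne {θ : ℝ} (h0 : 0 ≤ θ) (hpi : θ ≤ Real.pi) {p q : ℝ} (hp : p ≠ 0) :
    ENNReal.ofReal (2 * θ) ≤ volume ({t : ℝ | sgn (Real.cos t * p + Real.sin t * q) ≠
      sgn (Real.cos (t + θ) * p + Real.sin (t + θ) * q)} ∩ Set.Ioc 0 (0 + 2 * Real.pi)) := by
  have hz : (⟨p, q⟩ : ℂ) ≠ 0 := fun h => hp (congrArg Complex.re h)
  have hn : 0 < ‖(⟨p, q⟩ : ℂ)‖ := norm_pos_iff.mpr hz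
  have h1 := Complex.norm_mul_cos_arg ⟨p, q⟩
  have h2 := Complex.norm_mul_sin_arg ⟨p, q⟩
  have e : ∀ t, Real.cos t * p + Real.sin t * q =
      ‖(⟨p, q⟩ : ℂ)‖ * Real.cos (t - Complex.arg ⟨p, q⟩) := by
    intro t
    simp only at h1 h2
    rw [Real.cos_sub]
    linear_combination -Real.cos t * h1 - Real.sin t * h2
  simp only [e, sgn_mul_of_pos hn]
  exact le_volume_sgn_cos_ne h0 hpi _

variable {E : Type*} [NormedAddCommGroup E] [InnerProductSpace ℝ E]

/-- The vectors that define a hyperplane which separates `u` and `v`. -/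
def separating (u v : E) : Set E := {x | sgn ⟪u, x⟫ ≠ sgn ⟪v, x⟫}

theorem separating_comm (u v : E) : separating u v = separating v u := by
  ext x
  exact ne_comm

/-- The direction at angle `t` in the plane spanned by `u` and `w`. -/
noncomputable def planeDir (u w : E) (t : ℝ) : E := Real.cos t • u + Real.sin t • w

theorem inner_planeDir (u w x : E) (t : ℝ) :
    ⟪planeDir u w t, x⟫ = Real.cos t * ⟪u, x⟫ + Real.sin t * ⟪w, x⟫ := by
  simp [planeDir, inner_add_left, inner_smul_left]

theorem inner_planeDir_planeDir {u w : E} (hu : ‖u‖ = 1) (hw : ‖w‖ = 1) (huw : ⟪u, w⟫ = 0)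
    (s t : ℝ) : ⟪planeDir u w s, planeDir u w t⟫ = Real.cos (t - s) := by
  have h : ⟪w, u⟫ = 0 := by rw [real_inner_comm, huw]
  rw [inner_planeDir, planeDir, inner_add_right, inner_add_right, inner_smul_right,
    inner_smul_right, inner_smul_right, inner_smul_right, real_inner_self_eq_norm_sq,
    real_inner_self_eq_norm_sq, hu, hw, huw, h, Real.cos_sub]
  ring

theorem norm_planeDir {u w : E} (hu : ‖u‖ = 1) (hw : ‖w‖ = 1) (huw : ⟪u, w⟫ = 0) (t : ℝ) :
    ‖planeDir u w t‖ = 1 := by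
  have := inner_planeDir_planeDir hu hw huw t t
  rw [sub_self, Real.cos_zero, real_inner_self_eq_norm_sq] at this
  nlinarith [norm_nonneg (planeDir u w t)]

/-- Reflections serve in place of plane rotations: the reflection in the direction at angle c/2 maps
angle s to c - s. -/
theorem reflection_planeDir {u w : E} (hu : ‖u‖ = 1) (hw : ‖w‖ = 1) (huw : ⟪u, w⟫ = 0) (c s : ℝ) :
    (ℝ ∙ planeDir u w (c / 2)).reflection (planeDir u w s) = planeDir u w (c - s) := by
  rw [Submodule.reflection_singleton_apply, inner_planeDir_planeDir hu hw huw,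
    norm_planeDir hu hw huw]
  have h1 : Real.cos (c - s) = 2 * Real.cos (s - c / 2) * Real.cos (c / 2) - Real.cos s := by
    have e1 : c - s = c / 2 - (s - c / 2) := by ring
    have e2 : Real.cos s = Real.cos (c / 2 + (s - c / 2)) := by ring_nf
    rw [e1, e2, Real.cos_sub, Real.cos_add]
    ring
  have h2 : Real.sin (c - s) = 2 * Real.cos (s - c / 2) * Real.sin (c / 2) - Real.sin s := by
    have e1 : c - s = c / 2 - (s - c / 2) := by ring
    have e2 : Real.sin s = Real.sin (c / 2 + (s - c / 2)) := by ring_nf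
    rw [e1, e2, Real.sin_sub, Real.sin_add]
    ring
  rw [planeDir, planeDir, planeDir, h1, h2]
  simp only [RCLike.ofReal_real_eq_id, id_eq, one_pow, div_one]
  module

/-- Dimension at least two is needed when v = ±u, where a normal direction w must be supplied from
outside the span of u and v. -/
theorem exists_planeDir [FiniteDimensional ℝ E] (hE : 1 < Module.finrank ℝ E) {u v : E} (hu : ‖u‖ = 1) (hv : ‖v‖ = 1) :
    ∃ w : E, ‖w‖ = 1 ∧ ⟪u, w⟫ = 0 ∧ v = planeDir u w (Real.arccos ⟪u, v⟫) := by
  have hb := abs_le.mp ((abs_real_inner_le_norm u v).trans (by rw [hu, hv, one_mul]))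
  have hc : Real.cos (Real.arccos ⟪u, v⟫) = ⟪u, v⟫ := Real.cos_arccos hb.1 hb.2
  have hn := norm_orthPart hu hv
  have ho := inner_orthPart hu v
  by_cases hz : orthPart u v = 0
  · obtain ⟨w, hw0, hw⟩ : ∃ w : E, w ≠ 0 ∧ ⟪u, w⟫ = 0 := by
      have hu0 : u ≠ 0 := by
        rintro rfl
        simp at hu
      have h1 := Submodule.finrank_add_finrank_orthogonal (ℝ ∙ u)
      rw [finrank_span_singleton hu0] at h1
      have h2 : 0 < Module.finrank ℝ (ℝ ∙ u)ᗮ := by omega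
      have := Module.finrank_pos_iff.mp h2
      obtain ⟨⟨w, hw⟩, hw0⟩ := exists_ne (0 : (ℝ ∙ u)ᗮ)
      refine ⟨w, fun h => hw0 (Subtype.ext h), ?_⟩
      exact Submodule.mem_orthogonal_singleton_iff_inner_right.mp hw
    refine ⟨‖w‖⁻¹ • w, ?_, ?_, ?_⟩
    · rw [norm_smul, norm_inv, norm_norm, inv_mul_cancel₀ (norm_ne_zero_iff.mpr hw0)]
    · rw [inner_smul_right, hw, mul_zero]
    · rw [planeDir, hc, ← hn, hz, norm_zero, zero_smul, add_zero]
      rwa [orthPart, sub_eq_zero] at hz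
  · have hn0 := norm_ne_zero_iff.mpr hz
    refine ⟨‖orthPart u v‖⁻¹ • orthPart u v, ?_, ?_, ?_⟩
    · rw [norm_smul, norm_inv, norm_norm, inv_mul_cancel₀ hn0]
    · rw [inner_smul_right, ho, mul_zero]
    · rw [planeDir, hc, ← hn, smul_smul, mul_inv_cancel₀ hn0, one_smul, orthPart]
      abel

variable [FiniteDimensional ℝ E] [MeasurableSpace E] [BorelSpace E]

theorem measurableSet_separating (u v : E) : MeasurableSet (separating u v) := by
  refine (measurableSet_eq_fun ?_ ?_).compl
  · exact measurable_sgn.comp (by fun_prop)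
  · exact measurable_sgn.comp (by fun_prop)

theorem volume_separating_map (f : E ≃ₗᵢ[ℝ] E) (u v : E) :
    volume (separating (f u) (f v) ∩ Metric.ball 0 1) =
      volume (separating u v ∩ Metric.ball 0 1) := by
  rw [← f.measurePreserving.measure_preimage
    ((measurableSet_separating (f u) (f v)).inter measurableSet_ball).nullMeasurableSet]
  congr 1
  ext x
  simp [separating]

/-- The reflection in the direction at angle (t + θ)/2 exchanges 0 with t + θ and θ with t, hence
carries one pair of directions to the other in reverse order. -/
theorem volume_separating_planeDir {u w : E} (hu : ‖u‖ = 1) (hw : ‖w‖ = 1) (huw : ⟪u, w⟫ = 0)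
    (t θ : ℝ) :
    volume (separating (planeDir u w t) (planeDir u w (t + θ)) ∩ Metric.ball 0 1) =
      volume (separating (planeDir u w 0) (planeDir u w θ) ∩ Metric.ball 0 1) := by
  rw [← volume_separating_map (ℝ ∙ planeDir u w ((t + θ) / 2)).reflection (planeDir u w 0),
    reflection_planeDir hu hw huw, reflection_planeDir hu hw huw, sub_zero, add_sub_cancel_right,
    separating_comm]

theorem volume_orthogonal_eq_zero {u : E} (hu : u ≠ 0) : volume {x : E | ⟪u, x⟫ = 0} = 0 := by
  have h : (ℝ ∙ u)ᗮ ≠ ⊤ := by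
    intro h
    have : u ∈ (ℝ ∙ u)ᗮ := h ▸ Submodule.mem_top
    rw [Submodule.mem_orthogonal_singleton_iff_inner_right] at this
    exact hu (inner_self_eq_zero.mp this)
  have := Measure.addHaar_submodule volume _ h
  convert this using 2
  ext x
  exact (Submodule.mem_orthogonal_singleton_iff_inner_right (u := u) (v := x)).symm

/-- The volume does not change when the pair of directions turns within its plane. Averaging over
all turns and exchanging the integrals, it is enough that for almost every fixed x the turns at
which x separates the pair have measure at least 2θ out of 2π. -/
theorem le_volume_separating_planeDir {u w : E} (hu : ‖u‖ = 1) (hw : ‖w‖ = 1) (huw : ⟪u, w⟫ = 0)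
    {θ : ℝ} (h0 : 0 ≤ θ) (hpi : θ ≤ Real.pi) :
    ENNReal.ofReal (2 * θ) * volume (Metric.ball (0 : E) 1) ≤ ENNReal.ofReal (2 * Real.pi) *
      volume (separating (planeDir u w 0) (planeDir u w θ) ∩ Metric.ball 0 1) := by
  obtain ⟨S, hS⟩ : ∃ S : Set (ℝ × E), S =
      {z | sgn ⟪planeDir u w z.1, z.2⟫ ≠ sgn ⟪planeDir u w (z.1 + θ), z.2⟫} := ⟨_, rfl⟩
  have hSm : MeasurableSet S := by
    rw [hS]
    simp only [inner_planeDir]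
    refine (measurableSet_eq_fun ?_ ?_).compl
    · exact measurable_sgn.comp (by fun_prop)
    · exact measurable_sgn.comp (by fun_prop)
  have h1 := Measure.prod_apply (μ := volume.restrict (Set.Ioc 0 (0 + 2 * Real.pi)))
    (ν := volume.restrict (Metric.ball (0 : E) 1)) hSm
  have h2 := Measure.prod_apply_symm (μ := volume.restrict (Set.Ioc 0 (0 + 2 * Real.pi)))
    (ν := volume.restrict (Metric.ball (0 : E) 1)) hSm
  have e1 : ∀ t, volume.restrict (Metric.ball (0 : E) 1) (Prod.mk t ⁻¹' S) =
      volume (separating (planeDir u w 0) (planeDir u w θ) ∩ Metric.ball 0 1) := by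
    intro t
    rw [Measure.restrict_apply (measurable_prodMk_left hSm), hS,
      ← volume_separating_planeDir hu hw huw t θ]
    rfl
  simp only [e1, lintegral_const, Measure.restrict_apply MeasurableSet.univ, Set.univ_inter,
    Real.volume_Ioc] at h1
  rw [h1, zero_add, sub_zero, mul_comm] at h2
  rw [h2]
  calc ENNReal.ofReal (2 * θ) * volume (Metric.ball (0 : E) 1)
      = ∫⁻ _ in Metric.ball (0 : E) 1, ENNReal.ofReal (2 * θ) := by simp
    _ ≤ _ := by
      refine lintegral_mono_ae ?_
      have hu0 : u ≠ 0 := by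
        rintro rfl
        simp at hu
      -- Points orthogonal to u are excluded, which guarantees that the projection of x to the plane
      -- is not zero.
      filter_upwards [ae_restrict_of_ae (measure_eq_zero_iff_ae_notMem.mp
        (volume_orthogonal_eq_zero hu0))] with x hx
      rw [Measure.restrict_apply (measurable_prodMk_right hSm), hS]
      have := le_volume_sgn_ne h0 hpi (p := ⟪u, x⟫) (q := ⟪w, x⟫) hx
      simpa only [inner_planeDir, zero_add, Set.preimage_ofPred_eq] using this

theorem le_volume_separating (hE : 1 < Module.finrank ℝ E) {u v : E} (hu : ‖u‖ = 1)
    (hv : ‖v‖ = 1) : ENNReal.ofReal (Real.arccos ⟪u, v⟫ / Real.pi) * volume (Metric.ball (0 : E) 1) ≤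
      volume (separating u v ∩ Metric.ball 0 1) := by
  obtain ⟨w, hw, huw, h⟩ := exists_planeDir hE hu hv
  have h1 := le_volume_separating_planeDir hu hw huw (Real.arccos_nonneg ⟪u, v⟫)
    (Real.arccos_le_pi _)
  rw [← h, show planeDir u w 0 = u by simp [planeDir]] at h1
  have hp := Real.two_pi_pos
  have h2 : Real.arccos ⟪u, v⟫ / Real.pi = 2 * Real.arccos ⟪u, v⟫ / (2 * Real.pi) := by
    rw [mul_div_mul_left _ _ two_ne_zero]
  rw [h2, ENNReal.ofReal_div_of_pos hp, ENNReal.div_eq_inv_mul, mul_assoc]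
  refine (mul_le_mul_right h1 _).trans_eq ?_
  rw [← mul_assoc, ENNReal.inv_mul_cancel, one_mul]
  · simpa using Real.pi_pos
  · exact ENNReal.ofReal_ne_top

end Hyperplane

/-! ### From the ball to the uniform distribution on the sphere -/

section RandomHyperplane

variable {V : Type*} [Fintype V]

open Pointwise in
/-- A random hyperplane separates two unit vectors with probability at least their angle divided by
`π`. -/
theorem le_uniformSphere_separating [Nonempty V] {u v : Vec V} (hu : ‖u‖ = 1) (hv : ‖v‖ = 1) :
    Real.arccos ⟪u, v⟫ / Real.pi ≤
      (uniformSphere V).real {r | (r : Vec V) ∈ separating u v} := by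
  have hE : 1 < Module.finrank ℝ (Vec V) := by
    have := Fintype.card_pos (α := V)
    rw [finrank_euclideanSpace_fin]
    omega
  have hm : MeasurableSet {r : Metric.sphere (0 : Vec V) 1 | (r : Vec V) ∈ separating u v} :=
    measurable_subtype_coe (measurableSet_separating u v)
  -- The surface measure of a set is, up to the dimension, the volume of the cone over it.
  -- Separation is invariant under positive scaling, and the origin does not separate because both
  -- signs are 1 there.
  have hsub : separating u v ∩ Metric.ball 0 1 ⊆ Set.Ioo (0 : ℝ) 1 •
      (Subtype.val '' {r : Metric.sphere (0 : Vec V) 1 | (r : Vec V) ∈ separating u v}) := by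
    rintro x ⟨hx, hb⟩
    have hx0 : x ≠ 0 := by
      rintro rfl
      simp [separating] at hx
    have hn : 0 < ‖x‖ := norm_pos_iff.mpr hx0
    refine Set.mem_smul.mpr ⟨‖x‖, ⟨hn, by simpa using hb⟩, ‖x‖⁻¹ • x, ⟨⟨‖x‖⁻¹ • x, ?_⟩, ?_, rfl⟩, ?_⟩
    · rw [mem_sphere_zero_iff_norm, norm_smul, norm_inv, norm_norm, inv_mul_cancel₀ hn.ne']
    · change sgn _ ≠ sgn _
      rw [inner_smul_right, inner_smul_right, sgn_mul_of_pos (inv_pos.mpr hn),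
        sgn_mul_of_pos (inv_pos.mpr hn)]
      exact hx
    · rw [smul_smul, mul_inv_cancel₀ hn.ne', one_smul]
  have h0 : (volume : Measure (Vec V)).toSphere Set.univ ≠ 0 := by
    rw [Measure.toSphere_apply_univ]
    exact mul_ne_zero (by simp) (Metric.measure_ball_pos _ _ one_pos).ne'
  have key : ENNReal.ofReal (Real.arccos ⟪u, v⟫ / Real.pi) ≤
      uniformSphere V {r | (r : Vec V) ∈ separating u v} := by
    rw [uniformSphere, Measure.smul_apply, smul_eq_mul, ← ENNReal.div_eq_inv_mul,
      ENNReal.le_div_iff_mul_le (Or.inl h0) (Or.inl (measure_ne_top _ _)),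
      Measure.toSphere_apply_univ, Measure.toSphere_apply' _ hm, mul_left_comm]
    gcongr
    exact (le_volume_separating hE hu hv).trans (measure_mono hsub)
  exact (ENNReal.ofReal_le_iff_le_toReal (measure_ne_top _ _)).mp key

end RandomHyperplane

/-! ### Optimal solutions of the relaxation and the upper bound they give -/

section Relaxation

variable {V : Type*} [Fintype V]

theorem isCompact_setOf_isFeasible : IsCompact {v : Option V → Vec V | IsFeasible v} := by
  have hcl : IsClosed {v : Option V → Vec V | IsFeasible v} := by
    have e : {v : Option V → Vec V | IsFeasible v} =
        (⋂ i, {v | ⟪v i, v i⟫ = 1}) ∩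
        ((⋂ i : V, ⋂ j : V, {v | -1 ≤ ⟪v (some i), v (some j)⟫ + ⟪v none, v (some i)⟫ +
          ⟪v none, v (some j)⟫}) ∩
        ((⋂ i : V, ⋂ j : V, {v | -1 ≤ ⟪v (some i), v (some j)⟫ - ⟪v none, v (some i)⟫ -
          ⟪v none, v (some j)⟫}) ∩
        ((⋂ i : V, ⋂ j : V, {v | -1 ≤ -⟪v (some i), v (some j)⟫ - ⟪v none, v (some i)⟫ +
          ⟪v none, v (some j)⟫}) ∩
        (⋂ i : V, ⋂ j : V, {v | -1 ≤ -⟪v (some i), v (some j)⟫ + ⟪v none, v (some i)⟫ -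
          ⟪v none, v (some j)⟫})))) := by
      ext v
      simp only [Set.mem_inter_iff, Set.mem_iInter, Set.mem_ofPred_eq]
      exact ⟨fun h => ⟨h.1, h.2, h.3, h.4, h.5⟩, fun h => ⟨h.1, h.2.1, h.2.2.1, h.2.2.2.1, h.2.2.2.2⟩⟩
    rw [e]
    refine (isClosed_iInter fun i => isClosed_eq ?_ continuous_const).inter
      ((isClosed_iInter fun i => isClosed_iInter fun j => isClosed_le continuous_const ?_).inter
      ((isClosed_iInter fun i => isClosed_iInter fun j => isClosed_le continuous_const ?_).inter
      ((isClosed_iInter fun i => isClosed_iInter fun j => isClosed_le continuous_const ?_).inter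
      (isClosed_iInter fun i => isClosed_iInter fun j => isClosed_le continuous_const ?_)))) <;>
    fun_prop
  refine (isCompact_univ_pi fun _ : Option V =>
    isCompact_closedBall (0 : Vec V) 1).of_isClosed_subset hcl ?_
  intro v hv i _
  have := hv.unit i
  rw [real_inner_self_eq_norm_sq] at this
  rw [mem_closedBall_zero_iff]
  nlinarith [norm_nonneg (v i)]

theorem IsFeasible.norm_eq {v : Option V → Vec V} (hv : IsFeasible v) (i : Option V) :
    ‖v i‖ = 1 := by
  have := hv.unit i
  rw [real_inner_self_eq_norm_sq] at this
  nlinarith [norm_nonneg (v i)]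

/-- The solution of the relaxation that corresponds to the influence set on which `b` vanishes. -/
noncomputable def signVec (b : V → ℝ) : Option V → Vec V
  | none => EuclideanSpace.single 0 1
  | some i => (1 - 2 * b i) • EuclideanSpace.single 0 1

theorem isFeasible_signVec {b : V → ℝ} (hb : ∀ i, b i = 0 ∨ b i = 1) :
    IsFeasible (signVec b) := by
  constructor
  · rintro (_ | i)
    · simp [signVec]
    · rcases hb i with h | h <;> norm_num [signVec, h]
  all_goals
    intro i j
    rcases hb i with h | h <;> rcases hb j with h' | h' <;>
      norm_num [signVec, inner_smul_left, inner_smul_right, h, h']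

variable [LinearOrder V]

/-- A continuous objective attains its maximum on the compact feasible set, which contains the
solution with all vectors equal. -/
theorem exists_isOptimal (G : UndirectedNetwork V) (p : ℝ) : ∃ v, IsOptimal G p v := by
  obtain ⟨v, hv, hmax⟩ := isCompact_setOf_isFeasible.exists_isMaxOn (f := sdpObjective G p)
    ⟨_, isFeasible_signVec (V := V) (b := fun _ => 0) fun _ => Or.inl rfl⟩
    (Continuous.continuousOn (by unfold sdpObjective; fun_prop))
  exact ⟨v, hv, fun u hu => hmax hu⟩

theorem sum_sum_ne_eq (f : V → V → ℝ) :
    ∑ i, ∑ j with j ≠ i, f i j = ∑ i, ∑ j with i < j, (f i j + f j i) := by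
  have h : ∑ i, ∑ j with i < j, f j i = ∑ i, ∑ j with j < i, f i j := by
    simp only [Finset.sum_filter]
    exact Finset.sum_comm
  simp only [Finset.sum_add_distrib]
  rw [h, ← Finset.sum_add_distrib]
  refine Finset.sum_congr rfl fun i _ => ?_
  simp only [Finset.sum_filter]
  rw [← Finset.sum_add_distrib]
  refine Finset.sum_congr rfl fun j _ => ?_
  rcases lt_trichotomy i j with hij | hij | hij
  · simp [hij, hij.ne', hij.not_gt]
  · simp [hij]
  · simp [hij, hij.ne, hij.not_gt]

/-- The revenue of `IE(A, p)` as a sum over loops and edges; `b` is the indicator of the exploit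
set. -/
theorem ieRevenue_eq_sum (G : UndirectedNetwork V) (A : Finset V) (p : ℝ) {b : V → ℝ}
    (hb : ∀ i, b i = if i ∈ A then 0 else 1) :
    ieRevenue G A p = p * (1 - p) * (∑ i, G.w i i * b i +
      ∑ i, ∑ j with i < j, G.w i j * (b i + b j - (2 - p) * (b i * b j))) := by
  rw [ieRevenue_eq]
  congr 1
  have h1 : ∀ f : V → ℝ, ∑ i ∈ Aᶜ, f i = ∑ i, b i * f i := by
    intro f
    rw [← Finset.sum_add_sum_compl A fun i => b i * f i, Finset.sum_eq_zero (s := A), zero_add]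
    · refine Finset.sum_congr rfl fun i hi => ?_
      rw [hb, if_neg (by simpa using hi), one_mul]
    · intro i hi
      rw [hb, if_pos hi, zero_mul]
  have h2 : ∀ f : V → ℝ, ∑ i ∈ A, f i = ∑ i, (1 - b i) * f i := by
    intro f
    have := Finset.sum_add_sum_compl A f
    rw [h1] at this
    simp only [sub_mul, one_mul, Finset.sum_sub_distrib]
    linarith
  have h3 : ∀ i, b i * (G.w i i + ∑ j ∈ A, G.w j i + ∑ j ∈ Aᶜ with j ≠ i, p * G.w j i / 2) =
      G.w i i * b i + ∑ j with j ≠ i,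
        G.w i j * (b i * (1 - b j) + p / 2 * (b i * b j)) := by
    intro i
    -- This removes the diagonal term j = i, which the sum over all of `A` turned into a sum over V
    -- would otherwise contain.
    have hi : b i * (1 - b i) = 0 := by rw [hb]; split_ifs <;> simp
    rw [h2, Finset.sum_filter, h1, mul_add, mul_add, Finset.mul_sum, Finset.mul_sum, add_assoc,
      ← Finset.sum_add_distrib, mul_comm, Finset.sum_filter]
    congr 1
    refine Finset.sum_congr rfl fun j _ => ?_
    by_cases hj : j = i
    · subst hj
      simp only [ne_eq, not_true_eq_false, if_false]
      rw [← mul_assoc, hi]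
      ring
    · simp only [ne_eq, hj, not_false_eq_true, if_true]
      rw [G.symm j i]
      ring
  rw [h1]
  simp only [h3]
  rw [Finset.sum_add_distrib, sum_sum_ne_eq]
  congr 1
  refine Finset.sum_congr rfl fun i _ => Finset.sum_congr rfl fun j _ => ?_
  rw [G.symm j i]
  ring

/-- The relaxation bounds the revenue of every IE strategy. -/
theorem ieRevenue_le_sdpObjective (G : UndirectedNetwork V) {p : ℝ} {v : Option V → Vec V}
    (hv : IsOptimal G p v) (A : Finset V) : ieRevenue G A p ≤ sdpObjective G p v := by
  obtain ⟨b, hb⟩ : ∃ b : V → ℝ, ∀ i, b i = if i ∈ A then 0 else 1 := ⟨_, fun _ => rfl⟩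
  have hf : IsFeasible (signVec b) := isFeasible_signVec fun i => by
    rw [hb]
    split_ifs <;> simp
  refine le_trans (le_of_eq ?_) (hv.2 _ hf)
  rw [ieRevenue_eq_sum G A p hb, sdpObjective, mul_add, Finset.mul_sum, Finset.mul_sum,
    Finset.mul_sum, Finset.mul_sum]
  congr 1
  · refine Finset.sum_congr rfl fun i _ => ?_
    simp only [signVec, inner_smul_right, EuclideanSpace.inner_single_left, map_one,
      PiLp.single_apply, if_true]
    ring
  · refine Finset.sum_congr rfl fun i _ => ?_
    rw [Finset.mul_sum, Finset.mul_sum]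
    refine Finset.sum_congr rfl fun j _ => ?_
    simp only [signVec, inner_smul_right, inner_smul_left, EuclideanSpace.inner_single_left,
      map_one, PiLp.single_apply, if_true, conj_trivial]
    ring

theorem bestIERevenue_le_sdpObjective (G : UndirectedNetwork V) {p : ℝ} {v : Option V → Vec V}
    (hv : IsOptimal G p v) : bestIERevenue G p ≤ sdpObjective G p v :=
  Finset.sup'_le _ _ fun A _ => ieRevenue_le_sdpObjective G hv A

end Relaxation

/-! ### Expected revenue of the rounded solution -/

section Expectation

variable {V : Type*} [Fintype V]

/-- The indicator of the event that the hyperplane orthogonal to `r` separates `u` and `v`. -/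
noncomputable def cutIndicator (u v : Vec V) : Metric.sphere (0 : Vec V) 1 → ℝ :=
  {r : Metric.sphere (0 : Vec V) 1 | (r : Vec V) ∈ separating u v}.indicator 1

theorem measurableSet_cut (u v : Vec V) :
    MeasurableSet {r : Metric.sphere (0 : Vec V) 1 | (r : Vec V) ∈ separating u v} :=
  measurable_subtype_coe (measurableSet_separating u v)

theorem integrable_cutIndicator (u v : Vec V) :
    Integrable (cutIndicator u v) (uniformSphere V) :=
  (integrable_const (1 : ℝ)).indicator (measurableSet_cut u v)

theorem le_integral_cutIndicator [Nonempty V] {u v : Vec V} (hu : ‖u‖ = 1) (hv : ‖v‖ = 1) :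
    Real.arccos ⟪u, v⟫ / Real.pi ≤ ∫ r, cutIndicator u v r ∂uniformSphere V := by
  rw [cutIndicator, integral_indicator_one (measurableSet_cut u v)]
  exact le_uniformSphere_separating hu hv

theorem sgn_eq_or (x : ℝ) : sgn x = 1 ∨ sgn x = -1 := by
  rw [sgn]
  split_ifs <;> simp

theorem cutIndicator_apply (u v : Vec V) (r : Metric.sphere (0 : Vec V) 1) :
    cutIndicator u v r = if sgn ⟪u, r⟫ = sgn ⟪v, r⟫ then 0 else 1 := by
  classical
  rw [cutIndicator, Set.indicator_apply]
  by_cases h : sgn ⟪u, (r : Vec V)⟫ = sgn ⟪v, (r : Vec V)⟫ <;> simp [separating, h]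

/-- Two signs differ exactly when one of them, but not both, differs from a third; the exclusive or
of bits s, t is s + t - 2st. -/
theorem cutIndicator_eq (x u v : Vec V) (r : Metric.sphere (0 : Vec V) 1) :
    cutIndicator u v r = cutIndicator x u r + cutIndicator x v r -
      2 * (cutIndicator x u r * cutIndicator x v r) := by
  rw [cutIndicator_apply, cutIndicator_apply, cutIndicator_apply]
  rcases sgn_eq_or ⟪x, (r : Vec V)⟫ with h1 | h1 <;> rcases sgn_eq_or ⟪u, (r : Vec V)⟫ with h2 | h2 <;>
    rcases sgn_eq_or ⟪v, (r : Vec V)⟫ with h3 | h3 <;> norm_num [h1, h2, h3]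

variable [LinearOrder V]

/-- The product of indicators is traded for the indicator of the cut between the two rotated
vectors. This makes the revenue a combination of cut indicators whose coefficients are non-negative
for p in [0, 1], so lower bounds on the separation probabilities suffice. -/
theorem sdpIERevenue_eq_sum (G : UndirectedNetwork V) (p γ : ℝ) (v : Option V → Vec V)
    (r : Metric.sphere (0 : Vec V) 1) :
    sdpIERevenue G p γ v r = p * (1 - p) *
      (∑ i, G.w i i * cutIndicator (v none) (rotate γ (v none) (v (some i))) r +
      ∑ i, ∑ j with i < j, G.w i j *
        (p / 2 * (cutIndicator (v none) (rotate γ (v none) (v (some i))) r +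
          cutIndicator (v none) (rotate γ (v none) (v (some j))) r) +
        (1 - p / 2) * cutIndicator (rotate γ (v none) (v (some i)))
          (rotate γ (v none) (v (some j))) r)) := by
  rw [sdpIERevenue, ieRevenue_eq_sum G _ p
    (b := fun i => cutIndicator (v none) (rotate γ (v none) (v (some i))) r)]
  · congr 2
    refine Finset.sum_congr rfl fun i _ => Finset.sum_congr rfl fun j _ => ?_
    rw [cutIndicator_eq (v none) (rotate γ (v none) (v (some i)))]
    ring
  · intro i
    rw [cutIndicator_apply]
    simp only [roundedSet, Finset.mem_filter, Finset.mem_univ, true_and, eq_comm]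

theorem integrable_sdpIERevenue (G : UndirectedNetwork V) (p γ : ℝ) (v : Option V → Vec V) :
    Integrable (sdpIERevenue G p γ v) (uniformSphere V) := by
  have : sdpIERevenue G p γ v = fun r => _ := funext fun r => sdpIERevenue_eq_sum G p γ v r
  rw [this]
  refine ((integrable_finsetSum _ fun i _ => (integrable_cutIndicator _ _).const_mul _).add
    (integrable_finsetSum _ fun i _ => integrable_finsetSum _ fun j _ =>
      ((((integrable_cutIndicator _ _).add (integrable_cutIndicator _ _)).const_mul _).add
        ((integrable_cutIndicator _ _).const_mul _)).const_mul _)).const_mul _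

theorem integral_sdpIERevenue (G : UndirectedNetwork V) (p γ : ℝ) (v : Option V → Vec V) :
    ∫ r, sdpIERevenue G p γ v r ∂uniformSphere V = p * (1 - p) *
      (∑ i, G.w i i * (∫ r, cutIndicator (v none) (rotate γ (v none) (v (some i))) r
          ∂uniformSphere V) +
      ∑ i, ∑ j with i < j, G.w i j *
        (p / 2 * ((∫ r, cutIndicator (v none) (rotate γ (v none) (v (some i))) r
            ∂uniformSphere V) +
          ∫ r, cutIndicator (v none) (rotate γ (v none) (v (some j))) r ∂uniformSphere V) +
        (1 - p / 2) * ∫ r, cutIndicator (rotate γ (v none) (v (some i)))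
          (rotate γ (v none) (v (some j))) r ∂uniformSphere V)) := by
  have h1 := fun i j : V => ((integrable_cutIndicator (v none)
    (rotate γ (v none) (v (some i)))).add (integrable_cutIndicator (v none)
      (rotate γ (v none) (v (some j))))).const_mul (p / 2)
  have h2 := fun i j : V => (integrable_cutIndicator (rotate γ (v none) (v (some i)))
    (rotate γ (v none) (v (some j)))).const_mul (1 - p / 2)
  have h3 := fun i j : V => ((h1 i j).add (h2 i j)).const_mul (G.w i j)
  have h4 := fun i : V => (integrable_cutIndicator (v none)
    (rotate γ (v none) (v (some i)))).const_mul (G.w i i)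
  simp only [Pi.add_apply] at h1 h2 h3 h4
  simp only [sdpIERevenue_eq_sum]
  rw [integral_const_mul, integral_add (integrable_finsetSum _ fun i _ => h4 i)
    (integrable_finsetSum _ fun i _ => integrable_finsetSum _ fun j _ => h3 i j),
    integral_finsetSum _ fun i _ => h4 i,
    integral_finsetSum _ fun i _ => integrable_finsetSum _ fun j _ => h3 i j]
  congr 2
  · exact Finset.sum_congr rfl fun i _ => integral_const_mul _ _
  · refine Finset.sum_congr rfl fun i _ => ?_
    rw [integral_finsetSum _ fun j _ => h3 i j]
    refine Finset.sum_congr rfl fun j _ => ?_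
    rw [integral_const_mul, integral_add (h1 i j) (h2 i j), integral_const_mul, integral_const_mul,
      integral_add (integrable_cutIndicator _ _) (integrable_cutIndicator _ _)]

/-- The expected revenue of `SDP-IE(0.586, 0.209)` in terms of the relaxation. -/
theorem mul_sdpObjective_le (G : UndirectedNetwork V) {v : Option V → Vec V} (hv : IsFeasible v) :
    0.9032 * sdpObjective G 0.586 v ≤
      ∫ r, sdpIERevenue G 0.586 0.209 v r ∂uniformSphere V := by
  have hpi := Real.pi_pos
  have hγ : (0.209 : ℝ) ∈ Set.Icc (0 : ℝ) 1 := by norm_num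
  have hn := hv.norm_eq
  have hx : ∀ i, Real.cos (Real.arccos ⟪v none, v (some i)⟫) = ⟪v none, v (some i)⟫ := fun i => by
    have := abs_le.mp ((abs_real_inner_le_norm (v none) (v (some i))).trans
      (by rw [hn, hn, one_mul]))
    exact Real.cos_arccos this.1 this.2
  have hr : ∀ i, ‖rotate 0.209 (v none) (v (some i))‖ = 1 := fun i => norm_rotate _ (hn _) (hn _)
  have single : ∀ i, rotAngle 0.209 (Real.arccos ⟪v none, v (some i)⟫) / Real.pi ≤
      ∫ r, cutIndicator (v none) (rotate 0.209 (v none) (v (some i))) r ∂uniformSphere V := by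
    intro i
    have : Nonempty V := ⟨i⟩
    rw [← arccos_inner_rotate hγ (hn none)]
    exact le_integral_cutIndicator (hn _) (hr i)
  have hS : 0.9032 * sdpObjective G 0.586 v = 0.586 * (1 - 0.586) *
      (∑ i, G.w i i * (0.4516 * (1 - ⟪v none, v (some i)⟫)) +
      ∑ i, ∑ j with i < j, G.w i j * (0.2258 * (2.586 - 0.586 * ⟪v none, v (some i)⟫ -
        0.586 * ⟪v none, v (some j)⟫ - 1.414 * ⟪v (some i), v (some j)⟫))) := by
    rw [sdpObjective]
    simp only [mul_add, Finset.mul_sum]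
    congr 1
    · refine Finset.sum_congr rfl fun i _ => ?_
      ring
    · refine Finset.sum_congr rfl fun i _ => Finset.sum_congr rfl fun j _ => ?_
      ring
  rw [hS, integral_sdpIERevenue]
  refine mul_le_mul_of_nonneg_left (add_le_add (Finset.sum_le_sum fun i _ => ?_)
    (Finset.sum_le_sum fun i _ => Finset.sum_le_sum fun j _ => ?_)) (by norm_num)
  · refine mul_le_mul_of_nonneg_left (le_trans ?_ (single i)) (G.nonneg i i)
    have := le_rotAngle (a := Real.arccos ⟪v none, v (some i)⟫)
      ⟨Real.arccos_nonneg _, Real.arccos_le_pi _⟩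
    rw [hx] at this
    rw [le_div_iff₀ hpi]
    linarith
  · refine mul_le_mul_of_nonneg_left ?_ (G.nonneg i j)
    have : Nonempty V := ⟨i⟩
    have h1 := single i
    have h2 := single j
    have h3 := le_integral_cutIndicator (hr i) (hr j)
    -- Of the four triangle inequalities only this one enters: it bounds the dihedral cosine from
    -- below.
    have h4 := edgeGap_inner_nonneg (hn none) (hn (some i)) (hn (some j)) (hv.triangle₁ i j)
    rw [edgeGap, edgeBase, edgeBase, hx, hx, rot, rot] at h4
    refine le_trans ?_ (add_le_add (mul_le_mul_of_nonneg_left (add_le_add h1 h2) (by norm_num))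
      (mul_le_mul_of_nonneg_left h3 (by norm_num)))
    rw [← add_div, mul_div_assoc', mul_div_assoc', ← add_div, le_div_iff₀ hpi]
    linarith

end Expectation

end SocialNetwork

theorem mainTheorem5 {V : Type*} [Fintype V] [LinearOrder V]
    (G : SocialNetwork.UndirectedNetwork V) :
    (∃ v, SocialNetwork.IsOptimal G 0.586 v) ∧
      ∀ v, SocialNetwork.IsOptimal G 0.586 v →
        Integrable (SocialNetwork.sdpIERevenue G 0.586 0.209 v)
            (SocialNetwork.uniformSphere V) ∧
          0.9032 * SocialNetwork.bestIERevenue G 0.586 ≤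
            ∫ r, SocialNetwork.sdpIERevenue G 0.586 0.209 v r
              ∂SocialNetwork.uniformSphere V := by
  refine ⟨SocialNetwork.exists_isOptimal G _, fun v hv =>
    ⟨SocialNetwork.integrable_sdpIERevenue G _ _ v, ?_⟩⟩
  exact (mul_le_mul_of_nonneg_left (SocialNetwork.bestIERevenue_le_sdpObjective G hv)
    (by norm_num)).trans (SocialNetwork.mul_sdpObjective_le G hv.1)
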